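/- Let $X$ be a scheme with structure sheaf $\mathscr{R}$ that is semi-separated (its diagonal over $\operatorname{Spec}\mathbb{Z}$ is affine; equivalently, the intersection of any two affine opens is affine) and locally coherent ($\mathscr{R}(U)$ is a coherent ring for every affine open $U\subseteq X$). A module $A$ over a commutative ring $R$ is called \emph{absolutely pure} if it is a pure submodule of every module containing it (that is, the inclusion stays injective after tensoring with any $R$-module), and \emph{absolutely clean} if $\operatorname{Ext}^1_R(N,A)=0$ for every $R$-module $N$ that has a projective resolution by finitely generated projective modules. A quasi-coherent sheaf $\mathscr{A}$ on $X$ is \emph{locally absolutely pure} if $\mathscr{A}(U)$ is an absolutely pure $\mathscr{R}(U)$-module for every affine open $U$; it is \emph{flat} if $\mathscr{A}(U)$ is a flat $\mathscr{R}(U)$-module for every affine open $U$. An (unbounded) chain complex $\mathscr{F}_\bullet$ of quasi-coherent sheaves is called an \emph{AC-acyclic complex of flat sheaves} if for every affine open $U$ all the modules $\mathscr{F}_n(U)$ are flat and $A\otimes_{\mathscr{R}(U)}\mathscr{F}_\bullet(U)$ is exact for every absolutely clean $\mathscr{R}(U)$-module $A$. (a) A quasi-coherent sheaf $\mathscr{A}$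 is locally absolutely pure if and only if there is an affine open cover of $X$ such that $\mathscr{A}(U)$ is an absolutely pure $\mathscr{R}(U)$-module for all $U$ in the cover. (b) Let $\mathscr{F}_\bullet$ be an (unbounded, not necessarily exact) chain complex of flat quasi-coherent sheaves. The following are equivalent: 1. $\mathscr{A}\otimes\mathscr{F}_\bullet$ is exact for all locally absolutely pure quasi-coherent sheaves $\mathscr{A}$. 2. $\mathscr{A}\otimes\mathscr{F}_\bullet$ is exact for all quasi-coherent sheaves $\mathscr{A}$ such that $\mathscr{A}(U)$ is an absolutely pure $\mathscr{R}(U)$-module for all $U$ in some affine open cover of $X$ (which may depend on $\mathscr{A}$). 3. $A\otimes_{\mathscr{R}(U)}\mathscr{F}_\bullet(U)$ is exact for all affine opens $U\subseteq X$ and all absolutely pure $\mathscr{R}(U)$-modules $A$. 4. There is an affine open cover of $X$ such that $A\otimes_{\mathscr{R}(U)}\mathscr{F}_\bullet(U)$ is exact for all $U$ in the cover and all absolutely pure $\mathscr{R}(U)$-modules $A$. 5. $I\otimes_{\mathscr{R}(U)}\mathscr{F}_\bullet(U)$ is exact for all affine opens $U\subseteq X$ and all injective $\mathscr{R}(U)$-modules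 $I$. 6. There is an affine open cover of $X$ such that $I\otimes_{\mathscr{R}(U)}\mathscr{F}_\bullet(U)$ is exact for all $U$ in the cover and all injective $\mathscr{R}(U)$-modules $I$. 7. $\mathscr{F}_\bullet$ is an AC-acyclic complex of flat sheaves. 8. There is an affine open cover of $X$ such that $A\otimes_{\mathscr{R}(U)}\mathscr{F}_\bullet(U)$ is exact for all $U$ in the cover and all absolutely clean $\mathscr{R}(U)$-modules $A$. (c) Being an AC-acyclic complex of flat sheaves is Zariski-local: a chain complex $\mathscr{F}_\bullet$ of quasi-coherent sheaves is an AC-acyclic complex of flat sheaves if and only if there is an affine open cover of $X$ such that, for every $U$ in the cover, all $\mathscr{F}_n(U)$ are flat and $A\otimes_{\mathscr{R}(U)}\mathscr{F}_\bullet(U)$ is exact for every absolutely clean $\mathscr{R}(U)$-module $A$. -/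

import Mathlib

open CategoryTheory AlgebraicGeometry Opposite

universe u

section Algebra

/-- A commutative ring is coherent if each of its finitely generated ideals is finitely
presented. -/
def IsCoherentRing (R : Type u) [CommRing R] : Prop :=
  ∀ I : Ideal R, I.FG → Module.FinitePresentation R I

/-- An injective linear map is pure if it stays injective after tensoring with any module. -/
def IsPureMono {R : Type u} [CommRing R] {M N : Type u} [AddCommGroup M] [Module R M]
    [AddCommGroup N] [Module R N] (f : M →ₗ[R] N) : Prop :=
  ∀ (P : Type u) [AddCommGroup P] [Module R P], Function.Injective (f.lTensor P)

/-- A module is absolutely pure if it is pure in every module that contains it. -/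
def IsAbsolutelyPure (R : Type u) [CommRing R] (M : Type u) [AddCommGroup M] [Module R M] : Prop :=
  ∀ (N : Type u) [AddCommGroup N] [Module R N] (f : M →ₗ[R] N),
    Function.Injective f → IsPureMono f

/-- A module is of type `FP_∞` if it has a projective resolution by finitely generated projective
modules. -/
def IsFPInfty {R : Type u} [CommRing R] (N : ModuleCat.{u} R) : Prop :=
  ∃ P : ProjectiveResolution N, ∀ n, Module.Finite R (P.complex.X n)

/-- A module `A` is absolutely clean if `Ext¹(N, A) = 0` for all modules `N` of type `FP_∞`. -/
def IsAbsolutelyClean {R : Type u} [CommRing R] (A : ModuleCat.{u} R) : Prop :=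
  ∀ N : ModuleCat.{u} R, IsFPInfty N → Subsingleton (Abelian.Ext.{u} N A 1)

/-- Exactness of the complex of modules `A ⊗ K`. -/
noncomputable def TensorExact {R : Type u} [CommRing R] (A : ModuleCat.{u} R)
    (K : ChainComplex (ModuleCat.{u} R) ℤ) : Prop :=
  (((MonoidalCategory.tensorLeft A).mapHomologicalComplex _).obj K).Acyclic

/-- A chain complex `K` (unbounded) is an AC-acyclic complex of flat modules if its terms are flat
and `A ⊗ K` is exact for every absolutely clean module `A`. -/
def IsACAcyclicComplex {R : Type u} [CommRing R] (K : ChainComplex (ModuleCat.{u} R) ℤ) : Prop :=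
  (∀ n, Module.Flat R (K.X n)) ∧ ∀ A : ModuleCat.{u} R, IsAbsolutelyClean A → TensorExact A K

end Algebra

section Sheaves

/-- The functor `M ↦ M(U)` from `𝒪_X`-modules to modules over `Γ(X, U)`. -/
noncomputable def sectionsFunctor {X : Scheme.{u}} (U : X.Opens) :
    X.Modules ⥤ ModuleCat.{u} Γ(X, U) where
  obj M := ModuleCat.of Γ(X, U) Γ(M, U)
  map φ := ModuleCat.ofHom
    { toFun := φ.app U
      map_add' := map_add _
      map_smul' := fun r x => φ.app_smul r x }

noncomputable instance {X : Scheme.{u}} (U : X.Opens) : (sectionsFunctor U).Additive where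
  map_add := rfl

/-- The presheaf `U ↦ A(U) ⊗ M(U)`, as a functor of `M`. -/
noncomputable def presheafTensorLeft {X : Scheme.{u}} (A : X.PresheafOfModules) :
    X.PresheafOfModules ⥤ X.PresheafOfModules :=
  MonoidalCategory.tensorLeft
    (C := PresheafOfModules.{u} (X.presheaf ⋙ forget₂ CommRingCat.{u} RingCat.{u})) A

/-- The tensor product `M ↦ A ⊗ M` of sheaves of modules: the sheaf associated with the presheaf
`U ↦ A(U) ⊗ M(U)`. -/
noncomputable def sheafTensorLeft {X : Scheme.{u}} (A : X.Modules) : X.Modules ⥤ X.Modules :=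
  Scheme.Modules.toPresheafOfModules X ⋙
    presheafTensorLeft ((Scheme.Modules.toPresheafOfModules X).obj A) ⋙
      PresheafOfModules.sheafification (𝟙 X.ringCatSheaf.obj)

noncomputable instance {X : Scheme.{u}} (A : X.PresheafOfModules) :
    (presheafTensorLeft A).PreservesZeroMorphisms where
  map_zero _ _ := by
    ext U : 1
    exact MonoidalPreadditive.whiskerLeft_zero (C := ModuleCat Γ(X, U.unop)) (X := A.obj U)
      (Y := _) (Z := _)

noncomputable instance {X : Scheme.{u}} (A : X.Modules) :
    (sheafTensorLeft A).PreservesZeroMorphisms where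
  map_zero _ _ :=
    (congrArg (PresheafOfModules.sheafification.{u} (𝟙 X.ringCatSheaf.obj)).map
      ((presheafTensorLeft ((Scheme.Modules.toPresheafOfModules X).obj A)).map_zero _ _)).trans
      (Functor.map_zero (PresheafOfModules.sheafification.{u} (𝟙 X.ringCatSheaf.obj)) _ _)

/-- Exactness of the complex of sheaves `A ⊗ F`. -/
def SheafTensorExact {X : Scheme.{u}} (A : X.Modules) (F : ChainComplex X.Modules ℤ) : Prop :=
  (((sheafTensorLeft A).mapHomologicalComplex _).obj F).Acyclic

/-- The complex of `Γ(X, U)`-modules `F(U)`. -/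
noncomputable def sectionsComplex {X : Scheme.{u}} (F : ChainComplex X.Modules ℤ) (U : X.Opens) :
    ChainComplex (ModuleCat.{u} Γ(X, U)) ℤ :=
  ((sectionsFunctor U).mapHomologicalComplex _).obj F

/-- A set of affine opens that covers the scheme. -/
def IsAffineCovering {X : Scheme.{u}} (𝒰 : Set X.Opens) : Prop :=
  (∀ U ∈ 𝒰, IsAffineOpen U) ∧ sSup 𝒰 = ⊤

/-- A scheme is semi-separated if its diagonal (over `Spec ℤ`) is affine; equivalently, the affine
opens form a basis that is closed under intersections of two. -/
def IsSemiSeparatedScheme (X : Scheme.{u}) : Prop :=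
  IsAffineHom (Limits.pullback.diagonal (Limits.terminal.from X))

/-- A scheme is locally coherent if its sections over any affine open form a coherent ring. -/
def IsLocallyCoherentScheme (X : Scheme.{u}) : Prop :=
  ∀ U : X.Opens, IsAffineOpen U → IsCoherentRing Γ(X, U)

/-- Flatness of a (quasi-coherent) sheaf: its sections over any affine open are flat. -/
def IsFlatSheaf {X : Scheme.{u}} (M : X.Modules) : Prop :=
  ∀ U : X.Opens, IsAffineOpen U → Module.Flat Γ(X, U) Γ(M, U)

/-- A (quasi-coherent) sheaf is locally absolutely pure if its sections over any affine open are
absolutely pure. -/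
def IsLocallyAbsolutelyPure {X : Scheme.{u}} (A : X.Modules) : Prop :=
  ∀ U : X.Opens, IsAffineOpen U → IsAbsolutelyPure Γ(X, U) Γ(A, U)

/-- The sections of `A` over every member of some affine covering are absolutely pure. -/
def IsAbsolutelyPureOnSomeCovering {X : Scheme.{u}} (A : X.Modules) : Prop :=
  ∃ 𝒰 : Set X.Opens, IsAffineCovering 𝒰 ∧ ∀ U ∈ 𝒰, IsAbsolutelyPure Γ(X, U) Γ(A, U)

/-- A complex of (quasi-coherent) sheaves is an AC-acyclic complex of flat sheaves if its sections
over any affine open form an AC-acyclic complex of flat modules. -/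
def IsACAcyclic {X : Scheme.{u}} (F : ChainComplex X.Modules ℤ) : Prop :=
  ∀ U : X.Opens, IsAffineOpen U → IsACAcyclicComplex (sectionsComplex F U)

/-- The sections of `F` over every member of some affine covering form an AC-acyclic complex of
flat modules. -/
def IsACAcyclicOnSomeCovering {X : Scheme.{u}} (F : ChainComplex X.Modules ℤ) : Prop :=
  ∃ 𝒰 : Set X.Opens, IsAffineCovering 𝒰 ∧ ∀ U ∈ 𝒰, IsACAcyclicComplex (sectionsComplex F U)

end Sheaves

/-! Everything reduces to one elementary form of absolute purity: a module is absolutely pure iff it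
is FP-injective, i.e. maps into it from finitely generated `K ⊆ R^n` extend to `R^n`
(`IsFPInjective.isPureMono`, `IsAbsolutelyPure.isFPInjective`). FP-injectivity descends along flat
base change by restriction of scalars and can be checked on a cover by basic opens. Over a coherent
ring `K` is finitely presented, so maps out of it commute with localization and FP-injectivity
localizes. The affine communication lemma then gives (a).

For (b), exactness of `A ⊗ K` passes to pure submodules, and an absolutely pure module is pure in an
injective one, so injective and absolutely pure modules test the same complexes. Over a coherent
ring `R^n/K` is of type `FP_∞`, so absolutely clean modules are FP-injective; injectives are
absolutely clean, so the third test class agrees too. These tests are Zariski-local: an absolutely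
pure `R_f`-module is absolutely pure over `R` and is its own localization, and conversely `A_f` is
absolutely pure over `R_f`.

Sheaves enter through two facts. For quasi-coherent terms, exactness of the sheaf tensor product is
the same as exactness on all affine sections. And an absolutely pure module `A` on an affine `U` is
the module of sections over `U` of a locally absolutely pure sheaf, the pushforward of the tilde
sheaf of `A`; it is quasi-coherent because semi-separatedness makes `U → X` affine. Part (c) adds
locality of flatness. -/

/-! ### Absolutely pure modules and FP-injectivity -/

section FPInjective

open TensorProduct

/-- A module is FP-injective if every homomorphism into it from a finitely generated submodule of
a finite free module extends to the free module. -/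
def IsFPInjective (R : Type u) [CommRing R] (M : Type u) [AddCommGroup M] [Module R M] : Prop :=
  ∀ (n : ℕ) (K : Submodule R (Fin n → R)), K.FG → ∀ g : K →ₗ[R] M,
    ∃ h : (Fin n → R) →ₗ[R] M, h ∘ₗ K.subtype = g

variable {R : Type u} [CommRing R] {M : Type u} [AddCommGroup M] [Module R M]

/-- A tensor that dies in `P ⊗ N` gives a finite linear system with constants in `M` and a solution
`y` in `N`. On the span `K` of the rows of the system, the map `e_i ↦ y_i` takes values in `f(M)`;
extending the resulting `K → M` to the free module gives a solution in `M`, so the tensor is already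
zero in `P ⊗ M`. -/
lemma IsFPInjective.isPureMono (hM : IsFPInjective R M) {N : Type u} [AddCommGroup N] [Module R N]
    (f : M →ₗ[R] N) (hf : Function.Injective f) : IsPureMono f := by
  classical
  intro P _ _
  rw [injective_iff_map_eq_zero]
  intro t ht
  obtain ⟨k, p, m, rfl⟩ := TensorProduct.exists_sum_tmul_eq t
  let π : (P →₀ R) →ₗ[R] P := Finsupp.linearCombination R id
  have hπ : Function.Surjective π := Finsupp.linearCombination_id_surjective R P
  let t' : (P →₀ R) ⊗[R] M := ∑ j, Finsupp.single (p j) (1 : R) ⊗ₜ m j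
  have h0 : π.rTensor N (f.lTensor (P →₀ R) t') = 0 := by
    simpa [t', π, LinearMap.rTensor_tmul] using ht
  have hex : Function.Exact ((LinearMap.ker π).subtype.rTensor N) (π.rTensor N) := by
    exact rTensor_exact (M := LinearMap.ker π) (N := P →₀ R) (P := P) N
      (LinearMap.exact_subtype_ker_map π) hπ
  obtain ⟨z, hz⟩ := (hex _).1 h0
  obtain ⟨l, κ, y, rfl⟩ := TensorProduct.exists_sum_tmul_eq z
  -- The system has one equation for each `q : P`, read off as the coordinate at `q`. Only the
  -- finitely many `q` in `s` below have a nonzero row.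
  have hc : ∀ q : P, ∑ i, (κ i : P →₀ R) q • y i =
      f (TensorProduct.finsuppScalarLeft R M P t' q) := by
    intro q
    have := congr(TensorProduct.finsuppScalarLeft R N P $hz q)
    simp only [map_sum, LinearMap.rTensor_tmul, Finsupp.coe_finsetSum, Finset.sum_apply,
      t', LinearMap.lTensor_tmul, TensorProduct.finsuppScalarLeft_apply_tmul_apply,
      Submodule.subtype_apply] at this ⊢
    simpa using this
  let r : P → Fin l → R := fun q i => (κ i : P →₀ R) q
  let s : Finset P := (Finset.univ : Finset (Fin l)).biUnion fun i => (κ i : P →₀ R).support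
  have hr : ∀ q, q ∉ s → r q = 0 := by
    intro q hq
    ext i
    by_contra hne
    exact hq (Finset.mem_biUnion.2 ⟨i, Finset.mem_univ _, Finsupp.mem_support_iff.2 hne⟩)
  let K : Submodule R (Fin l → R) := Submodule.span R (r '' s)
  have hK : K.FG := ⟨s.image r, by simp [K]⟩
  have hrK : ∀ q, r q ∈ K := by
    intro q
    by_cases hq : q ∈ s
    · exact Submodule.subset_span ⟨q, hq, rfl⟩
    · rw [hr q hq]; exact K.zero_mem
  let Y : (Fin l → R) →ₗ[R] N := Fintype.linearCombination R y
  have hYr : ∀ q, Y (r q) = f (TensorProduct.finsuppScalarLeft R M P t' q) := by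
    intro q
    rw [← hc q]
    simp [Y, Fintype.linearCombination_apply, r]
  have hYK : K ≤ (LinearMap.range f).comap Y := by
    rw [Submodule.span_le]
    rintro _ ⟨q, -, rfl⟩
    exact ⟨_, (hYr q).symm⟩
  let e := LinearEquiv.ofInjective f hf
  let g : K →ₗ[R] M := e.symm.toLinearMap ∘ₗ (Y.restrict hYK)
  have hg : ∀ x : K, f (g x) = Y x := by
    intro x
    have : (e (g x) : N) = Y x := by simp [g]
    simpa [e] using this
  obtain ⟨h, hh⟩ := hM l K hK g
  have hfin : t' = ∑ i, (κ i : P →₀ R) ⊗ₜ[R] h (Pi.single i 1) := by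
    apply (TensorProduct.finsuppScalarLeft R M P).injective
    ext q
    apply hf
    rw [← hYr q]
    have h1 : h (r q) = g ⟨r q, hrK q⟩ := by rw [← hh]; rfl
    have h2 : Y (r q) = f (h (r q)) := by rw [h1, hg]
    rw [h2]
    congr 1
    conv_lhs => rw [← Finset.univ_sum_single (r q)]
    simp only [map_sum, Finsupp.coe_finsetSum, Finset.sum_apply,
      TensorProduct.finsuppScalarLeft_apply_tmul_apply]
    refine Finset.sum_congr rfl fun i _ => ?_
    rw [← map_smul]
    congr 1
    ext j
    by_cases hij : j = i
    · subst hij; simp [r]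
    · simp [hij]
  have : π.rTensor M t' = 0 := by
    rw [hfin]
    simp only [map_sum, LinearMap.rTensor_tmul]
    refine Finset.sum_eq_zero fun i _ => ?_
    rw [(κ i).2, TensorProduct.zero_tmul]
  simpa [t', π] using this

lemma IsFPInjective.isAbsolutelyPure (hM : IsFPInjective R M) : IsAbsolutelyPure R M :=
  fun _ _ _ f hf => hM.isPureMono f hf

/-- The injection to test is `ι`, the pushout of `K ⊆ R^n` along `g`. In the pushout each `g(k_i)`
becomes a combination of the images of the `e_j`, so a tensor built from the coefficients vanishes
there. Purity makes it vanish over `M`, and the equational criterion for vanishing yields the values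
of the extension on the `e_j`. -/
lemma IsAbsolutelyPure.isFPInjective (hM : IsAbsolutelyPure R M) : IsFPInjective R M := by
  classical
  intro n K hK g
  obtain ⟨m, k, hk⟩ := Submodule.fg_iff_exists_fin_generating_family.1 hK
  have hkK : ∀ i, k i ∈ K := fun i => hk ▸ Submodule.subset_span ⟨i, rfl⟩
  let D : Submodule R (M × (Fin n → R)) := LinearMap.range (g.prod (-K.subtype))
  let ι : M →ₗ[R] (M × (Fin n → R)) ⧸ D := D.mkQ ∘ₗ LinearMap.inl R _ _
  have hι : Function.Injective ι := by
    rw [injective_iff_map_eq_zero]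
    intro x hx
    obtain ⟨z, hz⟩ := (Submodule.Quotient.mk_eq_zero _).1 hx
    have h2 : -(z : Fin n → R) = 0 := congr(($hz).2)
    have h1 : g z = x := congr(($hz).1)
    have : z = 0 := by ext1; simpa using h2
    rw [← h1, this, map_zero]
  -- The test module `R^m/C` imposes the relations `∑ i, k i j • p i = 0`, exactly those that kill
  -- `∑ i, p i ⊗ k i` once `k i` is expanded in the standard basis.
  let C : Submodule R (Fin m → R) :=
    Submodule.span R (Set.range fun j : Fin n => fun i : Fin m => k i j)
  let p : Fin m → (Fin m → R) ⧸ C := fun i => C.mkQ (Pi.single i 1)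
  have hp : Submodule.span R (Set.range p) = ⊤ := by
    have : Set.range p = C.mkQ '' Set.range (fun i : Fin m => (Pi.single i 1 : Fin m → R)) := by
      rw [← Set.range_comp]; rfl
    rw [this, ← Submodule.map_span]
    have h := (Pi.basisFun R (Fin m)).span_eq
    have h' : Set.range (fun i : Fin m => (Pi.single i 1 : Fin m → R)) =
      Set.range (Pi.basisFun R (Fin m)) := by congr 1; ext i : 1; simp
    rw [h', h, Submodule.map_top, Submodule.range_mkQ]
  have hpz : ∀ a : Fin m → R, ∑ i, a i • p i = C.mkQ a := by
    intro a
    simp only [p, ← map_smul, ← map_sum]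
    congr 1
    ext j
    simp [Pi.single_apply]
  have hι0 : ∀ i, ι (g ⟨k i, hkK i⟩) = D.mkQ (0, k i) := by
    intro i
    rw [← sub_eq_zero, ← LinearMap.map_zero D.mkQ]
    simp only [ι, LinearMap.comp_apply]
    rw [← map_sub, map_zero, Submodule.mkQ_apply, Submodule.Quotient.mk_eq_zero]
    exact ⟨⟨k i, hkK i⟩, by simp⟩
  have hsum : ∑ i, p i ⊗ₜ[R] g ⟨k i, hkK i⟩ = 0 := by
    apply hM _ ι hι ((Fin m → R) ⧸ C)
    rw [map_zero, map_sum]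
    simp only [LinearMap.lTensor_tmul, hι0]
    have : ∀ i, D.mkQ ((0 : M), k i) = ∑ j, k i j • D.mkQ ((0 : M), Pi.single j (1 : R)) := by
      intro i
      simp only [← map_smul, ← map_sum]
      congr 1
      ext j
      · simp [Prod.fst_sum]
      · simp [Prod.snd_sum, Pi.single_apply]
    simp only [this, TensorProduct.tmul_sum]
    rw [Finset.sum_comm]
    refine Finset.sum_eq_zero fun j _ => ?_
    simp only [← TensorProduct.smul_tmul, ← TensorProduct.sum_tmul]
    rw [hpz fun i => k i j, Submodule.mkQ_apply,
      (Submodule.Quotient.mk_eq_zero C).2 (Submodule.subset_span ⟨j, rfl⟩), TensorProduct.zero_tmul]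
  obtain ⟨q, a, y, h1, h2⟩ := TensorProduct.vanishesTrivially_of_sum_tmul_eq_zero R hp hsum
  have h3 : ∀ t, ∃ b : Fin n → R, ∑ j, b j • (fun i : Fin m => k i j) = fun i => a i t := by
    intro t
    have := h2 t
    rw [hpz fun i => a i t, Submodule.mkQ_apply, Submodule.Quotient.mk_eq_zero] at this
    exact (Submodule.mem_span_range_iff_exists_fun R).1 this
  choose b hb using h3
  refine ⟨Fintype.linearCombination R fun j => ∑ t, b t j • y t, ?_⟩
  have hspan : Submodule.span R (Set.range fun i => (⟨k i, hkK i⟩ : K)) = ⊤ := by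
    apply Submodule.map_injective_of_injective K.injective_subtype
    rw [Submodule.map_span, Submodule.map_top, Submodule.range_subtype, ← Set.range_comp]
    exact hk
  refine LinearMap.ext_on_range hspan fun i => ?_
  refine Eq.trans ?_ (h1 i).symm
  have hb' : ∀ t, a i t = ∑ j, b t j * k i j := fun t => by
    have := congrFun (hb t) i
    simpa using this.symm
  simp only [LinearMap.comp_apply, Submodule.subtype_apply, Fintype.linearCombination_apply,
    Finset.smul_sum, hb', Finset.sum_smul, smul_smul]
  rw [Finset.sum_comm]
  exact Finset.sum_congr rfl fun t _ => Finset.sum_congr rfl fun j _ => by rw [mul_comm]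

lemma Module.Injective.isFPInjective [Module.Injective R M] : IsFPInjective R M := by
  intro n K _ g
  obtain ⟨h, hh⟩ := Module.Injective.out K.subtype K.injective_subtype g
  exact ⟨h, LinearMap.ext hh⟩

/-- If `S` is flat over `R`, FP-injective `S`-modules are FP-injective over `R`. -/
lemma IsFPInjective.restrictScalars {S : Type u} [CommRing S] [Algebra R S] [Module.Flat R S]
    [Module S M] [IsScalarTower R S M] (hM : IsFPInjective S M) : IsFPInjective R M := by
  classical
  intro n K hK g
  let θ : S ⊗[R] (Fin n → R) ≃ₗ[S] (Fin n → S) := TensorProduct.piScalarRight R S S (Fin n)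
  -- Flatness makes `S ⊗ K` a finitely generated submodule of `S^n`, to which the hypothesis over
  -- `S` applies.
  let j : S ⊗[R] K →ₗ[S] (Fin n → S) := θ.toLinearMap ∘ₗ (K.subtype.baseChange S)
  have hj : Function.Injective j :=
    θ.injective.comp (Module.Flat.lTensor_preserves_injective_linearMap _ K.injective_subtype)
  let e := LinearEquiv.ofInjective j hj
  have : Module.Finite R K := Module.Finite.iff_fg.2 hK
  have hfg : (LinearMap.range j).FG := Module.Finite.iff_fg.1 (Module.Finite.range j)
  let G : S ⊗[R] K →ₗ[S] M := LinearMap.liftBaseChange S g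
  obtain ⟨h, hh⟩ := hM n (LinearMap.range j) hfg (G ∘ₗ e.symm.toLinearMap)
  refine ⟨(h ∘ₗ θ.toLinearMap).restrictScalars R ∘ₗ TensorProduct.mk R S (Fin n → R) 1, ?_⟩
  ext x
  have := congr($hh (e (1 ⊗ₜ x)))
  simpa [e, j, G] using this

end FPInjective

/-! ### Coherent rings, finite free resolutions, absolutely clean modules -/

section Coherent

variable {R : Type u} [CommRing R]

/-- Finitely generated submodules of finite free modules over a coherent ring are finitely
presented. -/
lemma IsCoherentRing.finitePresentation_of_fg (hR : IsCoherentRing R) :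
    ∀ (n : ℕ) (K : Submodule R (Fin n → R)), K.FG → Module.FinitePresentation R K := by
  intro n
  induction n with
  | zero => intro K _; infer_instance
  | succ n ih =>
    intro K hK
    -- The image of the first coordinate is a finitely generated ideal; the kernel is finitely
    -- generated and embeds in `R^n`. Hence `K` is an extension of finitely presented modules.
    let φ : K →ₗ[R] R := LinearMap.proj 0 ∘ₗ K.subtype
    have : Module.Finite R K := Module.Finite.iff_fg.2 hK
    have h1 : Module.FinitePresentation R (LinearMap.range φ) :=
      hR _ (Module.Finite.iff_fg.1 (Module.Finite.range φ))
    have hker : (LinearMap.ker φ.rangeRestrict).FG :=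
      Module.FinitePresentation.fg_ker _ φ.surjective_rangeRestrict
    let t : (Fin (n + 1) → R) →ₗ[R] (Fin n → R) := LinearMap.funLeft R R Fin.succ
    let ψ : LinearMap.ker φ.rangeRestrict →ₗ[R] (Fin n → R) :=
      t ∘ₗ K.subtype ∘ₗ (LinearMap.ker φ.rangeRestrict).subtype
    have hψ : Function.Injective ψ := by
      rw [injective_iff_map_eq_zero]
      intro x hx
      ext i
      refine Fin.cases ?_ (fun j => ?_) i
      · have : φ.rangeRestrict x.1 = 0 := x.2
        exact congr(($this : R))
      · exact congrFun hx j
    have : Module.Finite R (LinearMap.ker φ.rangeRestrict) := Module.Finite.iff_fg.2 hker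
    have h2 : Module.FinitePresentation R (LinearMap.range ψ) :=
      ih _ (Module.Finite.iff_fg.1 (Module.Finite.range ψ))
    have h3 : Module.FinitePresentation R (LinearMap.ker φ.rangeRestrict) :=

      .of_equiv (M := LinearMap.range ψ) (N := LinearMap.ker φ.rangeRestrict)
        (LinearEquiv.ofInjective ψ hψ).symm
    exact Module.finitePresentation_of_ker φ.rangeRestrict φ.surjective_rangeRestrict

/-- A finitely generated submodule of some finite free module. -/
structure FiniteFreeSubmodule (R : Type u) [CommRing R] where
  /-- the rank of the ambient free module -/
  rank : ℕ
  /-- the submodule -/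
  submodule : Submodule R (Fin rank → R)
  fg : submodule.FG

namespace FiniteFreeSubmodule

/-- By coherence `K` is finitely presented, so the kernel of a finite free cover is again finitely
generated and the construction can be iterated. -/
lemma exists_cover (hR : IsCoherentRing R) (K : FiniteFreeSubmodule R) :
    ∃ (L : FiniteFreeSubmodule R) (d : (Fin L.rank → R) →ₗ[R] (Fin K.rank → R)),
      LinearMap.range d = K.submodule ∧ LinearMap.ker d = L.submodule := by
  have := hR.finitePresentation_of_fg _ _ K.fg
  obtain ⟨m, f, hf⟩ := Module.Finite.exists_fin' R K.submodule
  have hfg := Module.FinitePresentation.fg_ker f hf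
  refine ⟨⟨m, LinearMap.ker f, hfg⟩, K.submodule.subtype ∘ₗ f, ?_, ?_⟩
  · rw [LinearMap.range_comp, LinearMap.range_eq_top.2 hf, Submodule.map_top,
      Submodule.range_subtype]
  · exact LinearMap.ker_comp_of_ker_eq_bot _ (Submodule.ker_subtype _)

/-- The kernels in a resolution of a finitely generated submodule by finite free modules. -/
noncomputable def syzygy (hR : IsCoherentRing R) (K : FiniteFreeSubmodule R) :
    ℕ → FiniteFreeSubmodule R
  | 0 => K
  | n + 1 => (exists_cover hR (syzygy hR K n)).choose

/-- The differentials in a resolution by finite free modules. -/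
noncomputable def differential (hR : IsCoherentRing R) (K : FiniteFreeSubmodule R) (n : ℕ) :
    (Fin (syzygy hR K (n + 1)).rank → R) →ₗ[R] (Fin (syzygy hR K n).rank → R) :=
  (exists_cover hR (syzygy hR K n)).choose_spec.choose

variable (hR : IsCoherentRing R) (K : FiniteFreeSubmodule R)

lemma range_differential (n : ℕ) :
    LinearMap.range (differential hR K n) = (syzygy hR K n).submodule :=
  (exists_cover hR (syzygy hR K n)).choose_spec.choose_spec.1

lemma ker_differential (n : ℕ) :
    LinearMap.ker (differential hR K n) = (syzygy hR K (n + 1)).submodule :=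
  (exists_cover hR (syzygy hR K n)).choose_spec.choose_spec.2

/-- A complex of finite free modules that resolves the quotient of a finite free module by a
finitely generated submodule. -/
noncomputable def complex : ChainComplex (ModuleCat.{u} R) ℕ :=
  ChainComplex.of (fun n => ModuleCat.of R (Fin (syzygy hR K n).rank → R))
    (fun n => ModuleCat.ofHom (differential hR K n)) fun n => by
      ext1
      refine LinearMap.range_le_ker_iff.1 ?_
      exact ((range_differential hR K (n + 1)).trans (ker_differential hR K n).symm).le

lemma complex_d (n : ℕ) :
    (complex hR K).d (n + 1) n = ModuleCat.ofHom (differential hR K n) :=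
  ChainComplex.of_d (fun n => ModuleCat.of R (Fin (syzygy hR K n).rank → R))
    (fun n => ModuleCat.ofHom (differential hR K n)) n

lemma complex_exactAt_succ (n : ℕ) : (complex hR K).ExactAt (n + 1) := by
  rw [HomologicalComplex.exactAt_iff' _ (n + 1 + 1) (n + 1) n (by simp) (by simp),
    ShortComplex.moduleCat_exact_iff_range_eq_ker]
  dsimp only [HomologicalComplex.sc', HomologicalComplex.shortComplexFunctor']
  rw [complex_d, complex_d]
  exact (range_differential hR K (n + 1)).trans (ker_differential hR K n).symm

/-- The quotient of a finite free module by a finitely generated submodule. -/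
noncomputable abbrev quotient : ModuleCat.{u} R := ModuleCat.of R ((Fin K.rank → R) ⧸ K.submodule)

/-- The resolution of the quotient of a finite free module by a finitely generated submodule. -/
noncomputable def projectiveResolution : ProjectiveResolution K.quotient where
  complex := complex hR K
  projective n := by
    have : Module.Projective R (Fin (syzygy hR K n).rank → R) := inferInstance
    exact (IsProjective.iff_projective _).1 this
  π := (ChainComplex.toSingle₀Equiv _ _).symm ⟨ModuleCat.ofHom K.submodule.mkQ, by
    rw [complex_d]
    ext1
    refine LinearMap.range_le_ker_iff.1 ?_
    refine ((range_differential hR K 0).trans ?_).le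
    exact K.submodule.ker_mkQ.symm⟩
  quasiIso := ⟨fun n => by
    cases n
    · rw [ChainComplex.quasiIsoAt₀_iff, ShortComplex.quasiIso_iff_of_zeros']
      · refine (ShortComplex.exact_and_epi_g_iff_of_iso
          (S₂ := ShortComplex.mk (ModuleCat.ofHom (differential hR K 0))
            (ModuleCat.ofHom K.submodule.mkQ) (by
              ext1
              refine LinearMap.range_le_ker_iff.1 ?_
              refine ((range_differential hR K 0).trans ?_).le
              exact K.submodule.ker_mkQ.symm)) ?_).2
          ⟨?_, ?_⟩
        · exact ShortComplex.isoMk (Iso.refl _) (Iso.refl _) (Iso.refl _)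
            (by simp [complex_d]; rfl) (by simp; rfl)
        · rw [ShortComplex.moduleCat_exact_iff_range_eq_ker]
          exact (range_differential hR K 0).trans K.submodule.ker_mkQ.symm
        · exact (ModuleCat.epi_iff_surjective _).2 K.submodule.mkQ_surjective
      all_goals rfl
    · rw [quasiIsoAt_iff_exactAt']
      · exact complex_exactAt_succ hR K _
      · apply ChainComplex.exactAt_succ_single_obj⟩

lemma isFPInfty_quotient (hR : IsCoherentRing R) (K : FiniteFreeSubmodule R) :
    IsFPInfty K.quotient :=
  ⟨projectiveResolution hR K, fun n =>
    inferInstanceAs (Module.Finite R (Fin (syzygy hR K n).rank → R))⟩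

end FiniteFreeSubmodule

/-- The obstruction to extending `K → A` to `R^n` lies in `Ext¹(R^n/K, A)`, which vanishes because
coherence makes `R^n/K` of type `FP_∞`. -/
lemma IsAbsolutelyClean.isFPInjective (hR : IsCoherentRing R) {A : ModuleCat.{u} R}
    (hA : IsAbsolutelyClean A) : IsFPInjective R A := by
  intro n K hK g
  let S : ShortComplex (ModuleCat.{u} R) :=
    ShortComplex.mk (ModuleCat.ofHom K.subtype) (ModuleCat.ofHom K.mkQ) (by
      ext1
      exact LinearMap.range_le_ker_iff.1 (K.range_subtype.trans K.ker_mkQ.symm).le)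
  have hS : S.ShortExact :=
    { exact := by
        rw [ShortComplex.moduleCat_exact_iff_range_eq_ker]
        exact K.range_subtype.trans K.ker_mkQ.symm
      mono_f := (ModuleCat.mono_iff_injective _).2 K.injective_subtype
      epi_g := (ModuleCat.epi_iff_surjective _).2 K.mkQ_surjective }
  have : Subsingleton (Abelian.Ext.{u} S.X₃ A 1) :=
    hA _ (FiniteFreeSubmodule.isFPInfty_quotient hR ⟨n, K, hK⟩)
  obtain ⟨x, hx⟩ := Abelian.Ext.contravariant_sequence_exact₁ hS A
    (Abelian.Ext.mk₀ (X := S.X₁) (ModuleCat.ofHom g)) (add_zero 1) (Subsingleton.elim _ _)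
  obtain ⟨h, rfl⟩ := (Abelian.Ext.mk₀_bijective _ _).2 x
  rw [Abelian.Ext.mk₀_comp_mk₀] at hx
  have := (Abelian.Ext.mk₀_bijective _ _).1 hx
  exact ⟨h.hom, congr(($this).hom)⟩

lemma Module.Injective.isAbsolutelyClean (A : ModuleCat.{u} R) [h : Module.Injective R A] :
    IsAbsolutelyClean A := by
  intro N _
  have : CategoryTheory.Injective A := (Module.injective_iff_injective_object R A).1 h
  exact Abelian.Ext.subsingleton_of_injective _ _ 0

end Coherent

/-! ### Localization and gluing of FP-injectivity -/

section Localization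

variable {R : Type u} [CommRing R] {M : Type u} [AddCommGroup M] [Module R M]

/-- Clearing denominators in the generators of `K'` gives `K ⊆ R^n`, finitely presented by
coherence. So a multiple by some `s` of the induced map `K → M'` lifts to `K → M`, which extends to
`R^n`; dividing by `s` gives the extension over `S`. -/
lemma IsFPInjective.of_isLocalizedModule (hR : IsCoherentRing R) (hM : IsFPInjective R M)
    (p : Submonoid R) {S : Type u} [CommRing S] [Algebra R S] [IsLocalization p S]
    {M' : Type u} [AddCommGroup M'] [Module R M'] [Module S M'] [IsScalarTower R S M']
    (l : M →ₗ[R] M') [IsLocalizedModule p l] : IsFPInjective S M' := by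
  classical
  intro n K' hK' g
  let c : (Fin n → R) →ₗ[R] (Fin n → S) :=
    LinearMap.pi fun i => Algebra.linearMap R S ∘ₗ LinearMap.proj i
  have hc : IsLocalizedModule p c := inferInstance
  obtain ⟨m, k, hk⟩ := Submodule.fg_iff_exists_fin_generating_family.1 hK'
  choose x hx using fun i => IsLocalizedModule.surj p c (k i)
  let K : Submodule R (Fin n → R) := Submodule.span R (Set.range fun i => (x i).1)
  have hK : K.FG := ⟨Finset.univ.image fun i => (x i).1, by simp [K]⟩
  have hcK : K ≤ (K'.restrictScalars R).comap c := by
    rw [Submodule.span_le]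
    rintro _ ⟨i, rfl⟩
    change c (x i).1 ∈ K'
    rw [← hx i, Submonoid.smul_def, ← algebraMap_smul S]
    exact K'.smul_mem _ (hk ▸ Submodule.subset_span ⟨i, rfl⟩)
  have := hR.finitePresentation_of_fg n K hK
  let c' : K →ₗ[R] K' :=
    { toFun := fun y => ⟨c y, hcK y.2⟩
      map_add' := fun y z => Subtype.ext (map_add c _ _)
      map_smul' := fun r y => Subtype.ext (map_smul c r _) }
  let g₁ : K →ₗ[R] M' := g.restrictScalars R ∘ₗ c'
  obtain ⟨g₀, s, hs⟩ := Module.FinitePresentation.exists_lift_of_isLocalizedModule p l g₁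
  obtain ⟨h₀, hh₀⟩ := hM n K hK g₀
  let u : S := IsLocalization.mk' S (1 : R) s
  have hu : u * algebraMap R S s = 1 := by simp [u]
  let h : (Fin n → S) →ₗ[S] M' :=
    Fintype.linearCombination S fun j => u • l (h₀ (Pi.single j 1))
  have hh : ∀ y : Fin n → R, h (c y) = u • l (h₀ y) := by
    intro y
    conv_rhs => rw [← Finset.univ_sum_single y]
    simp only [h, Fintype.linearCombination_apply, map_sum, Finset.smul_sum]
    refine Finset.sum_congr rfl fun j _ => ?_
    have : (Pi.single j (y j) : Fin n → R) = y j • Pi.single j 1 := by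
      rw [← Pi.single_smul, smul_eq_mul, mul_one]
    rw [this, map_smul, map_smul, smul_comm u (y j), ← algebraMap_smul S (y j)]
    rfl
  refine ⟨h, ?_⟩
  have hspan : Submodule.span S (Set.range fun i =>
      (⟨k i, hk ▸ Submodule.subset_span ⟨i, rfl⟩⟩ : K')) = ⊤ := by
    apply Submodule.map_injective_of_injective K'.injective_subtype
    rw [Submodule.map_span, Submodule.map_top, Submodule.range_subtype, ← Set.range_comp]
    exact hk
  refine LinearMap.ext_on_range hspan fun i => ?_
  have hxK : (x i).1 ∈ K := Submodule.subset_span ⟨i, rfl⟩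
  have h1 := congr($hs ⟨_, hxK⟩)
  have h2 : g₀ ⟨_, hxK⟩ = h₀ (x i).1 := by rw [← hh₀]; rfl
  have hunit : IsUnit (algebraMap R S (x i).2) := IsLocalization.map_units S (x i).2
  apply hunit.smul_left_cancel.1
  rw [← map_smul, ← map_smul]
  have h3 : algebraMap R S (x i).2 • k i = c (x i).1 := by
    rw [algebraMap_smul]; exact hx i
  have h4 : (algebraMap R S (x i).2 •
      (⟨k i, hk ▸ Submodule.subset_span ⟨i, rfl⟩⟩ : K')) = c' ⟨_, hxK⟩ :=
    Subtype.ext h3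
  have h5 : l (h₀ (x i).1) = algebraMap R S s • g (c' ⟨_, hxK⟩) := by
    rw [← h2, algebraMap_smul]; exact h1
  rw [h4]
  change h (c (x i).1) = _
  rw [hh, h5, smul_smul, hu, one_smul]

/-- The elements `r` for which `r • g` extends form an ideal. It lies in no maximal ideal, since for
each `r ∈ s` an extension over the localization at `r` descends after multiplication by a power of
`r`. -/
lemma IsFPInjective.of_span_eq_top (s : Set R) (hs : Ideal.span s = ⊤)
    {S : s → Type u} [∀ r, CommRing (S r)] [∀ r, Algebra R (S r)]
    [∀ r : s, IsLocalization.Away r.1 (S r)]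
    {M' : s → Type u} [∀ r, AddCommGroup (M' r)] [∀ r, Module R (M' r)] [∀ r, Module (S r) (M' r)]
    [∀ r, IsScalarTower R (S r) (M' r)] (l : ∀ r, M →ₗ[R] M' r)
    [∀ r : s, IsLocalizedModule.Away r.1 (l r)]
    (hM : ∀ r, IsFPInjective (S r) (M' r)) : IsFPInjective R M := by
  intro n K hK g
  have : Module.Finite R K := Module.Finite.iff_fg.2 hK
  let I : Ideal R :=
    { carrier := {r | ∃ h : (Fin n → R) →ₗ[R] M, h ∘ₗ K.subtype = r • g}
      add_mem' := by
        rintro a b ⟨h, hh⟩ ⟨h', hh'⟩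
        exact ⟨h + h', by rw [LinearMap.add_comp, hh, hh', add_smul]⟩
      zero_mem' := ⟨0, by simp⟩
      smul_mem' := by
        rintro a b ⟨h, hh⟩
        exact ⟨a • h, by rw [LinearMap.smul_comp, hh, smul_smul, smul_eq_mul]⟩ }
  suffices h : I = ⊤ by
    obtain ⟨h, hh⟩ := (Ideal.eq_top_iff_one I).1 h
    exact ⟨h, by rw [hh, one_smul]⟩
  by_contra hI
  obtain ⟨m, hm, hIm⟩ := Ideal.exists_le_maximal I hI
  have hsm : ¬ s ⊆ m := fun h => hm.ne_top (top_le_iff.1 (hs ▸ Ideal.span_le.2 h))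
  obtain ⟨r, hrm⟩ : ∃ r : s, r.1 ∉ m := by simpa [Set.not_subset] using hsm
  suffices ∃ N, r.1 ^ N ∈ I by
    obtain ⟨N, hN⟩ := this
    exact hrm (hm.isPrime.mem_of_pow_mem N (hIm hN))
  have : Module.Flat R (S r) := IsLocalization.flat (S r) (Submonoid.powers r.1)
  obtain ⟨h, hh⟩ := (hM r).restrictScalars (R := R) n K hK (l r ∘ₗ g)
  obtain ⟨h₀, ⟨_, a, rfl⟩, ha⟩ :=
    Module.FinitePresentation.exists_lift_of_isLocalizedModule (Submonoid.powers r.1) (l r) h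
  -- `h₀` restricted to `K` and `r ^ a • g` agree only after localization; as `K` is finitely
  -- generated, one further power of `r` makes them equal.
  obtain ⟨⟨_, b, rfl⟩, hb⟩ := Module.Finite.exists_smul_of_comp_eq_of_isLocalizedModule
    (Submonoid.powers r.1) (l r) (h₀ ∘ₗ K.subtype) (r.1 ^ a • g) (by
      rw [← LinearMap.comp_assoc, ha, LinearMap.comp_smul, ← hh]
      rfl)
  refine ⟨b + a, r.1 ^ b • h₀, ?_⟩
  rw [pow_add, mul_smul]
  exact hb

end Localization

/-! ### Exactness of tensor products and pure submodules -/

section TensorExact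

open TensorProduct

variable {R : Type u} [CommRing R]

lemma tensorExact_iff (A : ModuleCat.{u} R) (K : ChainComplex (ModuleCat.{u} R) ℤ) :
    TensorExact A K ↔ ∀ n, Function.Exact ((K.d (n + 1) n).hom.lTensor A)
      ((K.d n (n - 1)).hom.lTensor A) := by
  refine forall_congr' fun n => ?_
  rw [HomologicalComplex.exactAt_iff' _ (n + 1) n (n - 1) (by simp) (by simp),
    ShortComplex.ShortExact.moduleCat_exact_iff_function_exact]
  rfl

/-- A cycle lies in the image of `u` iff it dies in the tensor product with the cokernel of `u`.
This holds after passing to `B`, and purity, applied to that cokernel, brings it back to `A`. -/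
lemma Function.Exact.lTensor_of_isPureMono {A B F G H : Type u} [AddCommGroup A] [AddCommGroup B]
    [AddCommGroup F] [AddCommGroup G] [AddCommGroup H] [Module R A] [Module R B] [Module R F]
    [Module R G] [Module R H] {f : A →ₗ[R] B} (hf : IsPureMono f) {u : F →ₗ[R] G} {v : G →ₗ[R] H}
    (huv : v ∘ₗ u = 0) (h : Function.Exact (u.lTensor B) (v.lTensor B)) :
    Function.Exact (u.lTensor A) (v.lTensor A) := by
  have hq (C : Type u) [AddCommGroup C] [Module R C] :
      Function.Exact (u.lTensor C) ((LinearMap.range u).mkQ.lTensor C) :=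
    lTensor_exact C (LinearMap.exact_map_mkQ_range u) (Submodule.mkQ_surjective _)
  intro z
  refine ⟨fun hz => ?_, ?_⟩
  · have h1 : v.lTensor B (f.rTensor G z) = 0 := by
      rw [← LinearMap.comp_apply, LinearMap.lTensor_comp_rTensor, ← LinearMap.rTensor_comp_lTensor,
        LinearMap.comp_apply, hz, map_zero]
    have h2 := (hq B _).2 ((h _).1 h1)
    rw [← LinearMap.comp_apply, LinearMap.lTensor_comp_rTensor, ← LinearMap.rTensor_comp_lTensor,
      LinearMap.comp_apply] at h2
    have hinj : Function.Injective (f.rTensor (G ⧸ LinearMap.range u)) := by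
      rw [← LinearMap.lTensor_inj_iff_rTensor_inj]
      exact hf _
    exact (hq A z).1 (hinj (h2.trans (map_zero _).symm))
  · rintro ⟨w, rfl⟩
    rw [← LinearMap.comp_apply, ← LinearMap.lTensor_comp, huv, LinearMap.lTensor_zero,
      LinearMap.zero_apply]

lemma TensorExact.of_isPureMono {A B : ModuleCat.{u} R} {K : ChainComplex (ModuleCat.{u} R) ℤ}
    {f : A →ₗ[R] B} (hf : IsPureMono f) (h : TensorExact B K) : TensorExact A K := by
  rw [tensorExact_iff] at h ⊢
  exact fun n => (h n).lTensor_of_isPureMono hf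
    (congrArg ModuleCat.Hom.hom (K.d_comp_d (n + 1) n (n - 1)))

/-- Tensor exactness for injective modules implies tensor exactness for absolutely pure ones. -/
lemma TensorExact.of_isAbsolutelyPure {K : ChainComplex (ModuleCat.{u} R) ℤ}
    (h : ∀ I : ModuleCat.{u} R, Module.Injective R I → TensorExact I K)
    (A : ModuleCat.{u} R) (hA : IsAbsolutelyPure R A) : TensorExact A K := by
  have hI : Module.Injective R (Injective.under A : ModuleCat.{u} R) :=
    (Module.injective_iff_injective_object R _).2 (inferInstanceAs (Injective (Injective.under A)))
  exact (h _ hI).of_isPureMono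
    (hA _ (Injective.ι A).hom ((ModuleCat.mono_iff_injective _).1 inferInstance))

end TensorExact

/-! ### Localization of tensor products -/

section TensorLocalization

open TensorProduct

variable {R : Type u} [CommRing R] (p : Submonoid R) {S : Type u} [CommRing S] [Algebra R S]
  [IsLocalization p S]

variable {A A' F F' G G' H H' : Type u} [AddCommGroup A] [AddCommGroup A'] [AddCommGroup F]
  [AddCommGroup F'] [AddCommGroup G] [AddCommGroup G'] [AddCommGroup H] [AddCommGroup H']
  [Module R A] [Module R A'] [Module S A'] [IsScalarTower R S A']
  [Module R F] [Module R F'] [Module S F'] [IsScalarTower R S F']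
  [Module R G] [Module R G'] [Module S G'] [IsScalarTower R S G']
  [Module R H] [Module R H'] [Module S H'] [IsScalarTower R S H']

/-- The map `A ⊗ F → A' ⊗ F'` of tensor products over `R` and `S` that is induced by maps `A → A'`
and `F → F'`. -/
noncomputable def tensorLocalizationMap (a : A →ₗ[R] A') (f : F →ₗ[R] F') :
    A ⊗[R] F →ₗ[R] A' ⊗[S] F' :=
  (IsLocalization.moduleTensorEquiv p S A' F').symm.toLinearMap.restrictScalars R ∘ₗ
    TensorProduct.map a f

lemma tensorLocalizationMap_tmul (a : A →ₗ[R] A') (f : F →ₗ[R] F') (x : A) (y : F) :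
    tensorLocalizationMap p (S := S) a f (x ⊗ₜ y) = a x ⊗ₜ[S] f y :=
  rfl

instance (a : A →ₗ[R] A') (f : F →ₗ[R] F') [IsLocalizedModule p a] [IsLocalizedModule p f] :
    IsLocalizedModule p (tensorLocalizationMap p (S := S) a f) :=
  IsLocalizedModule.of_linearEquiv p (TensorProduct.map a f)
    ((IsLocalization.moduleTensorEquiv p S A' F').symm.restrictScalars R)

lemma lTensor_comp_tensorLocalizationMap (a : A →ₗ[R] A') {f : F →ₗ[R] F'} {g : G →ₗ[R] G'}
    {u : F →ₗ[R] G} {u' : F' →ₗ[S] G'} (hu : ∀ x, u' (f x) = g (u x)) (z : A ⊗[R] F) :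
    u'.lTensor A' (tensorLocalizationMap p (S := S) a f z) =
      tensorLocalizationMap p (S := S) a g (u.lTensor A z) := by
  induction z with
  | zero => simp
  | add x y hx hy => simp only [map_add, hx, hy]
  | tmul x y => simp [tensorLocalizationMap_tmul, hu]

/-- This turns being a boundary on a basic open into being a boundary up to a denominator, the form
needed for gluing over elements that generate the unit ideal. -/
lemma exists_smul_mem_range_lTensor (a : A →ₗ[R] A') {f : F →ₗ[R] F'} {g : G →ₗ[R] G'}
    [IsLocalizedModule p a] [IsLocalizedModule p f] [IsLocalizedModule p g]
    {u : F →ₗ[R] G} {u' : F' →ₗ[S] G'} (hu : ∀ x, u' (f x) = g (u x)) (z : A ⊗[R] G)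
    (hz : tensorLocalizationMap p (S := S) a g z ∈ LinearMap.range (u'.lTensor A')) :
    ∃ s : p, s • z ∈ LinearMap.range (u.lTensor A) := by
  obtain ⟨w', hw'⟩ := hz
  obtain ⟨⟨w, s⟩, hw⟩ := IsLocalizedModule.surj p (tensorLocalizationMap p (S := S) a f) w'
  have h1 : tensorLocalizationMap p (S := S) a g (u.lTensor A w) =
      tensorLocalizationMap p (S := S) a g (s • z) := by
    rw [← lTensor_comp_tensorLocalizationMap p a hu, ← hw]
    refine (((u'.lTensor A').restrictScalars R).map_smul (s : R) w').trans ?_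
    rw [LinearMap.restrictScalars_apply, hw']
    exact ((tensorLocalizationMap p (S := S) a g).map_smul (s : R) z).symm
  obtain ⟨t, ht⟩ := IsLocalizedModule.exists_of_eq (S := p) h1
  refine ⟨t * s, t • w, ?_⟩
  rw [mul_smul, ← ht]
  simp only [Submonoid.smul_def, map_smul]

lemma Function.Exact.lTensor_of_isLocalizedModule (a : A →ₗ[R] A') {f : F →ₗ[R] F'}
    {g : G →ₗ[R] G'} {h : H →ₗ[R] H'}
    [IsLocalizedModule p a] [IsLocalizedModule p f] [IsLocalizedModule p g] [IsLocalizedModule p h]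
    {u : F →ₗ[R] G} {u' : F' →ₗ[S] G'} (hu : ∀ x, u' (f x) = g (u x))
    {v : G →ₗ[R] H} {v' : G' →ₗ[S] H'} (hv : ∀ x, v' (g x) = h (v x))
    (hex : Function.Exact (u.lTensor A) (v.lTensor A)) :
    Function.Exact (u'.lTensor A') (v'.lTensor A') := by
  have key := IsLocalizedModule.map_exact p (tensorLocalizationMap p (S := S) a f)
    (tensorLocalizationMap p (S := S) a g) (tensorLocalizationMap p (S := S) a h) _ _ hex
  have h1 : IsLocalizedModule.map p (tensorLocalizationMap p (S := S) a f)
      (tensorLocalizationMap p (S := S) a g) (u.lTensor A) =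
        (u'.lTensor A').restrictScalars R := by
    apply IsLocalizedModule.linearMap_ext p (tensorLocalizationMap p (S := S) a f)
      (tensorLocalizationMap p (S := S) a g)
    refine LinearMap.ext fun z => ?_
    simp only [LinearMap.comp_apply, IsLocalizedModule.map_apply, LinearMap.restrictScalars_apply]
    exact (lTensor_comp_tensorLocalizationMap p a hu z).symm
  have h2 : IsLocalizedModule.map p (tensorLocalizationMap p (S := S) a g)
      (tensorLocalizationMap p (S := S) a h) (v.lTensor A) =
        (v'.lTensor A').restrictScalars R := by
    apply IsLocalizedModule.linearMap_ext p (tensorLocalizationMap p (S := S) a g)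
      (tensorLocalizationMap p (S := S) a h)
    refine LinearMap.ext fun z => ?_
    simp only [LinearMap.comp_apply, IsLocalizedModule.map_apply, LinearMap.restrictScalars_apply]
    exact (lTensor_comp_tensorLocalizationMap p a hv z).symm
  rw [h1, h2] at key
  exact key

end TensorLocalization

/-! ### Quasi-coherence in terms of sections over basic opens -/

section Quasicoherent

open Scheme.Modules

/-- A presentation is made of free modules, so it can be carried through an equivalence once the
unit is matched by `η`. -/
lemma SheafOfModules.nonempty_presentation_of_equivalence {C D : Type u} [Category.{u} C]
    [Category.{u} D] {J : GrothendieckTopology C} {K : GrothendieckTopology D}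
    {R : Sheaf J RingCat.{u}} {S : Sheaf K RingCat.{u}} [HasSheafify J AddCommGrpCat.{u}]
    [J.WEqualsLocallyBijective AddCommGrpCat.{u}] [HasSheafify K AddCommGrpCat.{u}]
    [K.WEqualsLocallyBijective AddCommGrpCat.{u}]
    (e : SheafOfModules.{u} R ≌ SheafOfModules.{u} S)
    (η : e.functor.obj (SheafOfModules.unit R) ≅ SheafOfModules.unit S) {M : SheafOfModules.{u} R}
    {N : SheafOfModules.{u} S} (i : N ≅ e.functor.obj M) (P : N.Presentation) :
    Nonempty M.Presentation :=
  ⟨(P.map e.inverse (e.unitIso.app _ ≪≫ e.inverse.mapIso η)).ofIsIso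
    (e.inverse.mapIso i ≪≫ (e.unitIso.app M).symm).hom⟩

lemma SheafOfModules.nonempty_presentation_of_iso {C : Type u} [Category.{u} C]
    {J : GrothendieckTopology C} {R : Sheaf J RingCat.{u}} [HasSheafify J AddCommGrpCat.{u}]
    [J.WEqualsLocallyBijective AddCommGrpCat.{u}] {M N : SheafOfModules.{u} R} (i : N ≅ M)
    (P : N.Presentation) : Nonempty M.Presentation :=
  ⟨P.ofIsIso i.hom⟩

namespace AlgebraicGeometry

variable {X : Scheme.{u}}

/-- Sections over a basic open subset of `U`, as a module over the sections of `𝒪_X` over `U`. -/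
noncomputable instance moduleSectionsBasicOpen (M : X.Modules) {U : X.Opens} (f : Γ(X, U)) :
    Module Γ(X, U) Γ(M, X.basicOpen f) :=
  Module.compHom _ (algebraMap Γ(X, U) Γ(X, X.basicOpen f))

instance (M : X.Modules) {U : X.Opens} (f : Γ(X, U)) :
    IsScalarTower Γ(X, U) Γ(X, X.basicOpen f) Γ(M, X.basicOpen f) :=
  IsScalarTower.of_algebraMap_smul fun _ _ => rfl

/-- The restriction of sections of `M` from `U` to a basic open subset of `U`. -/
noncomputable def Scheme.Modules.toBasicOpen (M : X.Modules) {U : X.Opens} (f : Γ(X, U)) :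
    Γ(M, U) →ₗ[Γ(X, U)] Γ(M, X.basicOpen f) where
  toFun := M.presheaf.map (homOfLE (X.basicOpen_le f)).op
  map_add' := map_add _
  map_smul' r x := M.map_smul (homOfLE (X.basicOpen_le f)) r x

lemma Scheme.Modules.presheaf_map_map (M : X.Modules) {U V W : X.Opensᵒᵖ} (i : U ⟶ V) (j : V ⟶ W)
    (x : M.presheaf.obj U) : M.presheaf.map j (M.presheaf.map i x) = M.presheaf.map (i ≫ j) x := by
  rw [Functor.map_comp, ConcreteCategory.comp_apply]

lemma Scheme.Modules.isUnit_algebraMap_end_basicOpen (M : X.Modules) {U : X.Opens} (f : Γ(X, U)) :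
    IsUnit (algebraMap Γ(X, U) (Module.End Γ(X, U) Γ(M, X.basicOpen f)) f) := by
  have h := (X.toRingedSpace.isUnit_res_basicOpen f).map
    (algebraMap Γ(X, X.basicOpen f) (Module.End Γ(X, X.basicOpen f) Γ(M, X.basicOpen f)))
  rw [Module.End.isUnit_iff] at h ⊢
  exact h

/-- On the spectrum, `Γ(X, U)` acts through global sections of the structure sheaf; this action has
to be matched with restriction of functions in `X` before the two notions of localization can be
compared. -/
lemma IsAffineOpen.specSmul_restrictAppIso {U : X.Opens} (hU : IsAffineOpen U) (M : X.Modules)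
    (W : (Spec Γ(X, U)).Opens) (r : Γ(X, U)) (x : Γ(M.restrict hU.fromSpec, W))
    (hW : hU.fromSpec ''ᵁ W ≤ U) :
    (M.restrictAppIso hU.fromSpec W).hom (r • x) =
      X.presheaf.map (homOfLE hW).op r • (M.restrictAppIso hU.fromSpec W).hom x := by
  rw [smul_Spec_def, smul_restrictAppIso_hom_apply]
  congr 1
  have hle : W ≤ hU.fromSpec ⁻¹ᵁ U := by rw [hU.fromSpec_preimage_self]; exact le_top
  have h1 := hU.fromSpec.appLE_appIso_inv hle
  have h2 : hU.fromSpec.appLE U W hle =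
      (Scheme.ΓSpecIso Γ(X, U)).inv ≫ (Spec Γ(X, U)).presheaf.map W.leTop.op := by
    rw [Scheme.Hom.appLE, hU.fromSpec_app_self, Category.assoc, ← Functor.map_comp]
    rfl
  rw [h2] at h1
  exact congr(($h1).hom r)

lemma IsAffineOpen.isLocalizing_restrict_iff {U : X.Opens} (hU : IsAffineOpen U) (M : X.Modules) :
    IsLocalizing (modulesSpecToSheaf.obj (M.restrict hU.fromSpec)) ↔
      ∀ f : Γ(X, U), IsLocalizedModule.Away f (M.toBasicOpen f) := by
  refine forall_congr' fun f => ?_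
  have htop : hU.fromSpec ''ᵁ ⊤ = U := by
    rw [Scheme.Hom.image_top_eq_opensRange, hU.opensRange_fromSpec]
  let D : (Spec Γ(X, U)).Opens := PrimeSpectrum.basicOpen f
  have hf : hU.fromSpec ''ᵁ D = X.basicOpen f := hU.fromSpec_image_basicOpen f
  let a : Γ(M.restrict hU.fromSpec, ⊤) ≃ₗ[Γ(X, U)] Γ(M, U) :=
    { (M.restrictAppIso hU.fromSpec ⊤ ≪≫
        M.presheaf.mapIso (eqToIso htop.symm).op).addCommGroupIsoToAddEquiv with
      map_smul' := fun r x => by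
        change M.presheaf.map (eqToHom htop.symm).op
          ((M.restrictAppIso hU.fromSpec ⊤).hom (r • x)) =
            r • M.presheaf.map (eqToHom htop.symm).op ((M.restrictAppIso hU.fromSpec ⊤).hom x)
        rw [hU.specSmul_restrictAppIso M ⊤ r x htop.le, M.map_smul, ← ConcreteCategory.comp_apply,
          ← Functor.map_comp]
        have : (homOfLE htop.le).op ≫ (eqToHom htop.symm).op = 𝟙 (op U) := rfl
        rw [this, CategoryTheory.Functor.map_id]
        rfl }
  let b : Γ(M.restrict hU.fromSpec, D) ≃ₗ[Γ(X, U)] Γ(M, X.basicOpen f) :=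
    { (M.restrictAppIso hU.fromSpec D ≪≫
        M.presheaf.mapIso (eqToIso hf.symm).op).addCommGroupIsoToAddEquiv with
      map_smul' := fun r x => by
        change M.presheaf.map (eqToHom hf.symm).op
          ((M.restrictAppIso hU.fromSpec D).hom (r • x)) =
            r • M.presheaf.map (eqToHom hf.symm).op ((M.restrictAppIso hU.fromSpec D).hom x)
        rw [hU.specSmul_restrictAppIso M D r x (hf.le.trans (X.basicOpen_le f)), M.map_smul,
          ← ConcreteCategory.comp_apply, ← Functor.map_comp]
        rfl }
  have key : M.toBasicOpen f ∘ₗ a.toLinearMap = b.toLinearMap ∘ₗ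
      ((modulesSpecToSheaf.obj (M.restrict hU.fromSpec)).obj.map
        (homOfLE (le_top : D ≤ ⊤)).op).hom := by
    ext x
    have h1 := M.presheaf_map_map (eqToHom htop.symm).op (homOfLE (X.basicOpen_le f)).op x
    have h2 := M.presheaf_map_map (hU.fromSpec.opensFunctor.map (homOfLE (le_top : D ≤ ⊤))).op
      (eqToHom hf.symm).op x
    exact h1.trans h2.symm
  have h1 := IsLocalizedModule.comp_iff_of_bijective_left (S := Submonoid.powers f) b.toLinearMap
    b.bijective (f := ((modulesSpecToSheaf.obj (M.restrict hU.fromSpec)).obj.map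
        (homOfLE (le_top : D ≤ ⊤)).op).hom)
  have h2 := IsLocalizedModule.comp_iff_of_bijective_right (S := Submonoid.powers f) a.toLinearMap
    a.bijective (f := M.toBasicOpen f)
  rw [key] at h2
  exact h1.symm.trans h2

/-- The sections of a quasi-coherent sheaf over a basic open subset of an affine open subset are
a localization. -/
lemma IsAffineOpen.isLocalizedModule_toBasicOpen {U : X.Opens} (hU : IsAffineOpen U)
    {M : X.Modules} (hM : M.IsQuasicoherent) (f : Γ(X, U)) :
    IsLocalizedModule.Away f (M.toBasicOpen f) :=
  (hU.isLocalizing_restrict_iff M).1 ((isIso_fromTildeΓ_iff_isLocalizing _).1 inferInstance) f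

lemma IsAffineOpen.nonempty_presentation_restrict {U : X.Opens} (hU : IsAffineOpen U)
    (M : X.Modules) (h : ∀ f : Γ(X, U), IsLocalizedModule.Away f (M.toBasicOpen f)) :
    Nonempty (M.restrict hU.fromSpec).Presentation := by
  let N := M.restrict hU.fromSpec
  have : IsIso N.fromTildeΓ :=
    (isIso_fromTildeΓ_iff_isLocalizing N).2 ((hU.isLocalizing_restrict_iff M).2 h)
  let i : tilde _ ≅ N := asIso N.fromTildeΓ
  exact SheafOfModules.nonempty_presentation_of_iso i
    (presentationTilde.{u} _ .univ (by simp) _ (Submodule.span_eq _))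

/-- The presentation on the spectrum is restricted along `U ≅ Spec Γ(X, U)`, then transported to the
over-site of `U`, where quasi-coherence is defined. -/
lemma IsAffineOpen.nonempty_presentation_over {U : X.Opens} (hU : IsAffineOpen U)
    (M : X.Modules) (h : ∀ f : Γ(X, U), IsLocalizedModule.Away f (M.toBasicOpen f)) :
    Nonempty (SheafOfModules.Presentation.{u} (SheafOfModules.over M U)) := by
  obtain ⟨P⟩ := hU.nonempty_presentation_restrict M h
  let P₁ := presentationRestrict hU.isoSpec.hom P
  let e : (restrictFunctor hU.isoSpec.hom).obj (M.restrict hU.fromSpec) ≅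
      (overEquiv U).functor.obj (SheafOfModules.over M U) :=
    (restrictFunctorComp _ _).symm.app M ≪≫
      (restrictFunctorCongr (hU.isoSpec_hom_fromSpec)).app M ≪≫
      (overFunctorEquiv U).symm.app M
  exact SheafOfModules.nonempty_presentation_of_equivalence (overEquiv U)
    (U.sheafOfModulesEquivOverUnit X.ringCatSheaf) e P₁

/-- A sheaf of modules is quasi-coherent if its sections over basic open subsets of affine open
subsets are localizations. -/
lemma Scheme.Modules.isQuasicoherent_of_isLocalizedModule (M : X.Modules)
    (h : ∀ (U : X.Opens) (_ : IsAffineOpen U) (f : Γ(X, U)),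
      IsLocalizedModule.Away f (M.toBasicOpen f)) : M.IsQuasicoherent := by
  let q : SheafOfModules.QuasicoherentData.{u} (R := X.ringCatSheaf) M :=
    { I := X.affineOpens
      X := fun U => U.1
      coversTop := (Opens.coversTop_iff _ _).2 (iSup_affineOpens_eq_top X)
      presentation := fun U => (IsAffineOpen.nonempty_presentation_over U.2 M (h U.1 U.2)).some }
  exact q.isQuasicoherent

end AlgebraicGeometry

end Quasicoherent

/-! ### Zariski-locality of purity, flatness and tensor exactness -/

section Locality

variable {X : Scheme.{u}}

/-- The affine communication lemma, for a covering given by a set of opens. -/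
lemma IsAffineCovering.forall_of_basicOpen {P : X.Opens → Prop} {𝒰 : Set X.Opens}
    (h𝒰 : IsAffineCovering 𝒰) (h : ∀ U ∈ 𝒰, P U)
    (basicOpen : ∀ U : X.Opens, IsAffineOpen U → ∀ f : Γ(X, U), P U → P (X.basicOpen f))
    (span : ∀ U : X.Opens, IsAffineOpen U → ∀ s : Set Γ(X, U), Ideal.span s = ⊤ →
      (∀ f ∈ s, P (X.basicOpen f)) → P U)
    (V : X.Opens) (hV : IsAffineOpen V) : P V :=
  of_affine_open_cover (P := fun U => P U.1) (fun U : 𝒰 => ⟨U.1, h𝒰.1 U.1 U.2⟩)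
    ((sSup_eq_iSup' 𝒰).symm.trans h𝒰.2) ⟨V, hV⟩ (fun U f hU => basicOpen U.1 U.2 f hU)
    (fun U s hs hP => span U.1 U.2 s hs fun f hf => hP ⟨f, hf⟩) fun U => h U.1 U.2

variable (X) in
lemma isAffineCovering_affineOpens : IsAffineCovering {U : X.Opens | IsAffineOpen U} := by
  refine ⟨fun U hU => hU, ?_⟩
  rw [sSup_eq_iSup']
  exact iSup_affineOpens_eq_top X

/-- Absolute purity of the sections of a quasi-coherent sheaf can be tested on an affine
covering. -/
lemma IsAbsolutelyPureOnSomeCovering.isLocallyAbsolutelyPure (hX : IsLocallyCoherentScheme X)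
    {A : X.Modules} (hA : A.IsQuasicoherent) (h : IsAbsolutelyPureOnSomeCovering A) :
    IsLocallyAbsolutelyPure A := by
  obtain ⟨𝒰, h𝒰, h⟩ := h
  refine h𝒰.forall_of_basicOpen h (fun U hU f hP => ?_) fun U hU s hs hP => ?_
  · have := hU.isLocalization_basicOpen f
    have := hU.isLocalizedModule_toBasicOpen hA f
    exact (hP.isFPInjective.of_isLocalizedModule (hX U hU) (Submonoid.powers f)
      (A.toBasicOpen f)).isAbsolutelyPure
  · have (f : s) := hU.isLocalization_basicOpen f.1
    have (f : s) := hU.isLocalizedModule_toBasicOpen hA f.1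
    exact (IsFPInjective.of_span_eq_top s hs (fun f : s => A.toBasicOpen f.1)
      fun f => (hP f.1 f.2).isFPInjective).isAbsolutelyPure

lemma isLocallyAbsolutelyPure_iff (hX : IsLocallyCoherentScheme X) {A : X.Modules}
    (hA : A.IsQuasicoherent) : IsLocallyAbsolutelyPure A ↔ IsAbsolutelyPureOnSomeCovering A :=
  ⟨fun h => ⟨_, isAffineCovering_affineOpens X, h⟩, fun h => h.isLocallyAbsolutelyPure hX hA⟩

/-- Flatness of a quasi-coherent sheaf can be tested on an affine covering. -/
lemma isFlatSheaf_of_isAffineCovering {M : X.Modules} (hM : M.IsQuasicoherent)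
    {𝒰 : Set X.Opens} (h𝒰 : IsAffineCovering 𝒰)
    (h : ∀ U ∈ 𝒰, Module.Flat Γ(X, U) Γ(M, U)) : IsFlatSheaf M := by
  refine h𝒰.forall_of_basicOpen h (fun U hU f hP => ?_) fun U hU s hs hP => ?_
  · have := hU.isLocalization_basicOpen f
    have := hU.isLocalizedModule_toBasicOpen hM f
    exact Module.Flat.of_isLocalizedModule _ (Submonoid.powers f) (M.toBasicOpen f)
  · have (f : s) := hU.isLocalization_basicOpen f.1
    have (f : s) := hU.isLocalizedModule_toBasicOpen hM f.1
    refine Module.flat_of_isLocalized_span Γ(X, U) Γ(M, U) s hs (fun f : s => Γ(M, X.basicOpen f.1))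
      (fun f : s => M.toBasicOpen f.1) fun f => ?_
    have := hP f.1 f.2
    have : Module.Flat Γ(X, U) Γ(X, X.basicOpen f.1) :=
      IsLocalization.flat _ (Submonoid.powers f.1)
    exact Module.Flat.trans Γ(X, U) Γ(X, X.basicOpen f.1) Γ(M, X.basicOpen f.1)

/-- The map on sections over `U` that is induced by a morphism of sheaves of modules. -/
noncomputable def AlgebraicGeometry.Scheme.Modules.appₗ {M N : X.Modules} (φ : M ⟶ N)
    (U : X.Opens) : Γ(M, U) →ₗ[Γ(X, U)] Γ(N, U) :=
  ((sectionsFunctor U).map φ).hom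

lemma AlgebraicGeometry.Scheme.Modules.appₗ_map {M N : X.Modules} (φ : M ⟶ N) {U V : X.Opens}
    (i : V ⟶ U) (x : Γ(M, U)) :
    appₗ φ V (M.presheaf.map i.op x) = N.presheaf.map i.op (appₗ φ U x) :=
  ConcreteCategory.congr_hom (φ.mapPresheaf.naturality i.op) x

lemma AlgebraicGeometry.Scheme.Modules.appₗ_toBasicOpen {M N : X.Modules} (φ : M ⟶ N)
    {U : X.Opens} (f : Γ(X, U)) (x : Γ(M, U)) :
    appₗ φ (X.basicOpen f) (M.toBasicOpen f x) = N.toBasicOpen f (appₗ φ U x) :=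
  appₗ_map φ (homOfLE (X.basicOpen_le f)) x

variable {F : ChainComplex X.Modules ℤ}

open Scheme.Modules TensorProduct

lemma tensorExact_sectionsComplex_iff {U : X.Opens} (A : ModuleCat.{u} Γ(X, U)) :
    TensorExact A (sectionsComplex F U) ↔ ∀ n, Function.Exact
      ((appₗ (F.d (n + 1) n) U).lTensor A) ((appₗ (F.d n (n - 1)) U).lTensor A) :=
  tensorExact_iff _ _

lemma appₗ_d_comp_appₗ_d (i j k : ℤ) (U : X.Opens) :
    appₗ (F.d j k) U ∘ₗ appₗ (F.d i j) U = 0 :=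
  congrArg ModuleCat.Hom.hom ((sectionsComplex F U).d_comp_d i j k)

/-- Exactness of the tensor product with an absolutely pure module passes to basic open subsets. -/
lemma AlgebraicGeometry.IsAffineOpen.tensorExact_basicOpen {U : X.Opens} (hU : IsAffineOpen U)
    (hF : ∀ n, (F.X n).IsQuasicoherent) (f : Γ(X, U))
    (h : ∀ A : ModuleCat.{u} Γ(X, U), IsAbsolutelyPure Γ(X, U) A →
      TensorExact A (sectionsComplex F U)) (A : ModuleCat.{u} Γ(X, X.basicOpen f))
    (hA : IsAbsolutelyPure Γ(X, X.basicOpen f) A) :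
    TensorExact A (sectionsComplex F (X.basicOpen f)) := by
  have := hU.isLocalization_basicOpen f
  have (n : ℤ) := hU.isLocalizedModule_toBasicOpen (hF n) f
  have : Module.Flat Γ(X, U) Γ(X, X.basicOpen f) := IsLocalization.flat _ (Submonoid.powers f)
  -- Viewed over `Γ(X, U)`, the module `A` stays absolutely pure by flatness and is its own
  -- localization at `f`, so the exactness over `U` can be localized with `LinearMap.id` on the
  -- factor `A`.
  let : Module Γ(X, U) A := Module.compHom A (algebraMap Γ(X, U) Γ(X, X.basicOpen f))
  have : IsScalarTower Γ(X, U) Γ(X, X.basicOpen f) A :=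
    IsScalarTower.of_algebraMap_smul fun _ _ => rfl
  have hA' := (tensorExact_sectionsComplex_iff _).1
    (h (ModuleCat.of Γ(X, U) A) hA.isFPInjective.restrictScalars.isAbsolutelyPure)
  have := isLocalizedModule_id (Submonoid.powers f) A Γ(X, X.basicOpen f)
  refine (tensorExact_sectionsComplex_iff _).2 fun n => ?_
  exact (hA' n).lTensor_of_isLocalizedModule (Submonoid.powers f) LinearMap.id
    (f := (F.X (n + 1)).toBasicOpen f) (g := (F.X n).toBasicOpen f)
    (h := (F.X (n - 1)).toBasicOpen f) (appₗ_toBasicOpen (F.d (n + 1) n) f)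
    (appₗ_toBasicOpen (F.d n (n - 1)) f)

/-- Exactness of the tensor product with an absolutely pure module can be tested on a covering by
basic open subsets. -/
lemma AlgebraicGeometry.IsAffineOpen.tensorExact_of_span_eq_top {U : X.Opens} (hU : IsAffineOpen U)
    (hR : IsCoherentRing Γ(X, U)) (hF : ∀ n, (F.X n).IsQuasicoherent) (s : Set Γ(X, U))
    (hs : Ideal.span s = ⊤)
    (h : ∀ f ∈ s, ∀ A : ModuleCat.{u} Γ(X, X.basicOpen f), IsAbsolutelyPure Γ(X, X.basicOpen f) A →
      TensorExact A (sectionsComplex F (X.basicOpen f))) (A : ModuleCat.{u} Γ(X, U))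
    (hA : IsAbsolutelyPure Γ(X, U) A) : TensorExact A (sectionsComplex F U) := by
  refine (tensorExact_sectionsComplex_iff _).2 fun n z => ⟨fun hz => ?_, ?_⟩
  · refine Submodule.mem_of_span_eq_top_of_smul_pow_mem (LinearMap.range _) s hs z fun f => ?_
    have := hU.isLocalization_basicOpen f.1
    have (n : ℤ) := hU.isLocalizedModule_toBasicOpen (hF n) f.1
    -- The localization of `A` at `f`; it is absolutely pure by coherence, so the hypothesis on the
    -- basic open applies to it.
    let A' : ModuleCat.{u} Γ(X, X.basicOpen f.1) :=
      ModuleCat.of _ (Γ(X, X.basicOpen f.1) ⊗[Γ(X, U)] A)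
    let a : A →ₗ[Γ(X, U)] A' := TensorProduct.mk Γ(X, U) Γ(X, X.basicOpen f.1) A 1
    have : IsLocalizedModule (Submonoid.powers f.1) a :=
      (isLocalizedModule_iff_isBaseChange _ Γ(X, X.basicOpen f.1) _).2
        (TensorProduct.isBaseChange _ _ _)
    have hA' : IsAbsolutelyPure Γ(X, X.basicOpen f.1) A' :=
      (hA.isFPInjective.of_isLocalizedModule hR (Submonoid.powers f.1) a).isAbsolutelyPure
    have hex := (tensorExact_sectionsComplex_iff _).1 (h f.1 f.2 A' hA') n
    obtain ⟨⟨_, k, rfl⟩, hk⟩ := exists_smul_mem_range_lTensor (S := Γ(X, X.basicOpen f.1))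
      (Submonoid.powers f.1) a
      (f := (F.X (n + 1)).toBasicOpen f.1) (g := (F.X n).toBasicOpen f.1)
      (u := appₗ (F.d (n + 1) n) U)
      (u' := appₗ (F.d (n + 1) n) (X.basicOpen f.1))
      (appₗ_toBasicOpen (F.d (n + 1) n) f.1) z ((hex _).1 (by
        refine (lTensor_comp_tensorLocalizationMap (Submonoid.powers f.1) a
          (g := (F.X (n - 1)).toBasicOpen f.1) (u := appₗ (F.d n (n - 1)) U)
          (appₗ_toBasicOpen (F.d n (n - 1)) f.1) z).trans ?_
        rw [hz, map_zero]))
    exact ⟨k, hk⟩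
  · rintro ⟨w, rfl⟩
    rw [← LinearMap.comp_apply, ← LinearMap.lTensor_comp, appₗ_d_comp_appₗ_d,
      LinearMap.lTensor_zero, LinearMap.zero_apply]

lemma IsAffineCovering.tensorExact (hX : IsLocallyCoherentScheme X)
    (hF : ∀ n, (F.X n).IsQuasicoherent) {𝒰 : Set X.Opens} (h𝒰 : IsAffineCovering 𝒰)
    (h : ∀ U ∈ 𝒰, ∀ A : ModuleCat.{u} Γ(X, U), IsAbsolutelyPure Γ(X, U) A →
      TensorExact A (sectionsComplex F U)) (U : X.Opens) (hU : IsAffineOpen U) :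
    ∀ A : ModuleCat.{u} Γ(X, U), IsAbsolutelyPure Γ(X, U) A → TensorExact A (sectionsComplex F U) :=
  h𝒰.forall_of_basicOpen (P := fun U => ∀ A : ModuleCat.{u} Γ(X, U), IsAbsolutelyPure Γ(X, U) A →
      TensorExact A (sectionsComplex F U)) h
    (fun _ hU f hP => hU.tensorExact_basicOpen hF f hP)
    (fun U hU s hs hP => hU.tensorExact_of_span_eq_top (hX U hU) hF s hs hP) U hU

end Locality

/-! ### Extending modules from affine opens by pushforward -/

section Pushforward

open Scheme.Modules

/-- The preimage of an affine open subset in an affine open subset of a semi-separated scheme is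
affine. -/
lemma IsSemiSeparatedScheme.isAffineHom_fromSpec {X : Scheme.{u}} (hX : IsSemiSeparatedScheme X)
    {U : X.Opens} (hU : IsAffineOpen U) : IsAffineHom hU.fromSpec where
  isAffine_preimage V hV := by
    have : IsAffineHom (Limits.pullback.diagonal (Limits.terminal.from X)) := hX
    rw [← hU.fromSpec.isAffineOpen_iff_of_isOpenImmersion,
      hU.fromSpec.image_preimage_eq_opensRange_inf, hU.opensRange_fromSpec]
    exact hU.inf hV

/-- The open `V` is only propositionally a basic open, so that the statement applies directly to the
preimage of a basic open under a morphism. -/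
lemma AlgebraicGeometry.IsAffineOpen.exists_map_eq_of_eq_basicOpen {Y : Scheme.{u}} {W : Y.Opens}
    (hW : IsAffineOpen W) {M : Y.Modules} (hM : M.IsQuasicoherent) (f : Γ(Y, W)) {V : Y.Opens}
    (i : V ⟶ W) (hV : V = Y.basicOpen f) (y : Γ(M, V)) :
    ∃ (n : ℕ) (x : Γ(M, W)), Y.presheaf.map i.op (f ^ n) • y = M.presheaf.map i.op x := by
  subst hV
  have := hW.isLocalizedModule_toBasicOpen hM f
  obtain ⟨⟨x, _, n, rfl⟩, hx⟩ := IsLocalizedModule.surj (Submonoid.powers f) (M.toBasicOpen f) y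
  exact ⟨n, x, hx⟩

lemma AlgebraicGeometry.IsAffineOpen.exists_pow_smul_eq_of_map_eq {Y : Scheme.{u}} {W : Y.Opens}
    (hW : IsAffineOpen W) {M : Y.Modules} (hM : M.IsQuasicoherent) (f : Γ(Y, W)) {V : Y.Opens}
    (i : V ⟶ W) (hV : V = Y.basicOpen f) (x₁ x₂ : Γ(M, W))
    (hx : M.presheaf.map i.op x₁ = M.presheaf.map i.op x₂) :
    ∃ n : ℕ, f ^ n • x₁ = f ^ n • x₂ := by
  subst hV
  have := hW.isLocalizedModule_toBasicOpen hM f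
  obtain ⟨⟨_, n, rfl⟩, hn⟩ := IsLocalizedModule.exists_of_eq (S := Submonoid.powers f)
    (f := M.toBasicOpen f) hx
  exact ⟨n, hn⟩

/-- The pushforward of a quasi-coherent sheaf along an affine morphism is quasi-coherent. -/
lemma AlgebraicGeometry.Scheme.Modules.isQuasicoherent_pushforward {X Y : Scheme.{u}} (g : Y ⟶ X)
    [IsAffineHom g] {M : Y.Modules} (hM : M.IsQuasicoherent) :
    ((pushforward g).obj M).IsQuasicoherent := by
  refine isQuasicoherent_of_isLocalizedModule _ fun V hV f => ?_
  have hW : IsAffineOpen (g ⁻¹ᵁ V) := hV.preimage g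
  let i : g ⁻¹ᵁ X.basicOpen f ⟶ g ⁻¹ᵁ V := (TopologicalSpace.Opens.map g.base).map
    (homOfLE (X.basicOpen_le f))
  have hi : g ⁻¹ᵁ X.basicOpen f = Y.basicOpen (g.app V f) := Scheme.preimage_basicOpen g f
  have happ (r : Γ(X, V)) : g.app (X.basicOpen f) (X.presheaf.map (homOfLE (X.basicOpen_le f)).op r)
      = Y.presheaf.map i.op (g.app V r) :=
    ConcreteCategory.congr_hom (g.naturality (homOfLE (X.basicOpen_le f)).op) r
  refine ⟨?_, fun y => ?_, fun {x₁ x₂} hx => ?_⟩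
  · rintro ⟨_, n, rfl⟩
    rw [map_pow]
    exact (((pushforward g).obj M).isUnit_algebraMap_end_basicOpen f).pow n
  · obtain ⟨n, x, hx⟩ := hW.exists_map_eq_of_eq_basicOpen hM (g.app V f) i hi y
    rw [← map_pow, ← happ] at hx
    exact ⟨⟨x, f ^ n, n, rfl⟩, hx⟩
  · obtain ⟨n, hn⟩ := hW.exists_pow_smul_eq_of_map_eq hM (g.app V f) i hi x₁ x₂ hx
    rw [← map_pow] at hn
    exact ⟨⟨f ^ n, n, rfl⟩, hn⟩

lemma isFPInjective_tilde_basicOpen {R : CommRingCat.{u}} (hR : IsCoherentRing R)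
    {A : ModuleCat.{u} R} (hA : IsFPInjective R A) (f : R) {D : (Spec R).Opens}
    (hD : D = PrimeSpectrum.basicOpen f) : IsFPInjective Γ(Spec R, D) Γ(tilde A, D) := by
  have : IsLocalization.Away f Γ(Spec R, D) := by
    rw [hD]
    infer_instance
  let l : A →ₗ[R] Γ(tilde A, D) := (tilde.toOpen A D).hom
  have : IsLocalizedModule.Away f l := by
    subst hD
    exact inferInstanceAs
      (IsLocalizedModule.Away f (tilde.toOpen A (PrimeSpectrum.basicOpen f)).hom)
  exact hA.of_isLocalizedModule hR (Submonoid.powers f) l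

/-- The sections of the sheaf associated with an `FP`-injective module over a coherent ring are
`FP`-injective. -/
lemma isFPInjective_tilde {R : CommRingCat.{u}} (hR : IsCoherentRing R)
    {A : ModuleCat.{u} R} (hA : IsFPInjective R A) {W : (Spec R).Opens} (hW : IsAffineOpen W) :
    IsFPInjective Γ(Spec R, W) Γ(tilde A, W) := by
  -- Basic opens of `Spec R` inside `W` are also basic opens of `W` and cover it. Over them the
  -- sections are localizations of `A`, so `s` generates the unit ideal.
  let s : Set Γ(Spec R, W) :=
    {g | IsFPInjective Γ(Spec R, (Spec R).basicOpen g) Γ(tilde A, (Spec R).basicOpen g)}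
  have hs : Ideal.span s = ⊤ := by
    rw [← hW.self_le_iSup_basicOpen_iff]
    intro x hx
    obtain ⟨_, ⟨_, ⟨f, rfl⟩, rfl⟩, hxf, hfW⟩ :=
      PrimeSpectrum.isBasis_basic_opens.exists_subset_of_mem_open hx W.2
    let D : (Spec R).Opens := PrimeSpectrum.basicOpen f
    have hD : (Spec R).basicOpen ((Scheme.ΓSpecIso R).inv f) = D := basicOpen_eq_of_affine f
    let g : Γ(Spec R, W) :=
      (Spec R).presheaf.map W.leTop.op ((Scheme.ΓSpecIso R).inv f)
    have hg : (Spec R).basicOpen g = D :=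
      ((Spec R).basicOpen_res _ W.leTop.op).trans
        ((congrArg (W ⊓ ·) hD).trans (inf_eq_right.2 hfW))
    have hgs : g ∈ s := isFPInjective_tilde_basicOpen hR hA f hg
    exact TopologicalSpace.Opens.mem_iSup.2 ⟨⟨g, hgs⟩, hg.ge hxf⟩
  have (f : s) := hW.isLocalization_basicOpen f.1
  have (f : s) := hW.isLocalizedModule_toBasicOpen (M := tilde A) inferInstance f.1
  exact IsFPInjective.of_span_eq_top s hs (fun f : s => (tilde A).toBasicOpen f.1) fun f => f.2

variable {X : Scheme.{u}}

/-- An absolutely pure module over the sections over an affine open subset of a semi-separated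
locally coherent scheme extends to a locally absolutely pure sheaf. -/
lemma isLocallyAbsolutelyPure_pushforward_tilde (hsep : IsSemiSeparatedScheme X)
    {U : X.Opens} (hU : IsAffineOpen U) (hR : IsCoherentRing Γ(X, U)) {A : ModuleCat.{u} Γ(X, U)}
    (hA : IsAbsolutelyPure Γ(X, U) A) :
    IsLocallyAbsolutelyPure ((pushforward hU.fromSpec).obj (tilde A)) := by
  intro V hV
  have := hsep.isAffineHom_fromSpec hU
  have hW : IsAffineOpen (hU.fromSpec ⁻¹ᵁ V) := hV.preimage _
  algebraize [(hU.fromSpec.app V).hom]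
  -- An open immersion is flat, so FP-injectivity over the ring of the preimage restricts to `Γ(X,
  -- V)`.
  have : Module.Flat Γ(X, V) Γ(Spec Γ(X, U), hU.fromSpec ⁻¹ᵁ V) := by
    have := HasRingHomProperty.appLE @Flat hU.fromSpec inferInstance ⟨V, hV⟩ ⟨_, hW⟩ le_rfl
    rwa [← Scheme.Hom.app_eq_appLE] at this
  let : Module Γ(X, V) Γ(tilde A, hU.fromSpec ⁻¹ᵁ V) :=
    Module.compHom _ (algebraMap Γ(X, V) Γ(Spec Γ(X, U), hU.fromSpec ⁻¹ᵁ V))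
  have : IsScalarTower Γ(X, V) Γ(Spec Γ(X, U), hU.fromSpec ⁻¹ᵁ V)
    Γ(tilde A, hU.fromSpec ⁻¹ᵁ V) := .of_algebraMap_smul fun _ _ => rfl
  have h : IsFPInjective Γ(X, V) Γ(tilde A, hU.fromSpec ⁻¹ᵁ V) :=
    (isFPInjective_tilde hR hA.isFPInjective hW).restrictScalars
  exact h.isAbsolutelyPure

/-- The sections over `U` of the pushforward of the sheaf associated with a module over
`Γ(X, U)`. -/
lemma nonempty_linearEquiv_pushforward_tilde {U : X.Opens} (hU : IsAffineOpen U)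
    (A : ModuleCat.{u} Γ(X, U)) :
    Nonempty (A ≃ₗ[Γ(X, U)] Γ((pushforward hU.fromSpec).obj (tilde A), U)) := by
  have hbij (V : (Spec Γ(X, U)).Opens) (hV : V = ⊤) :
      Function.Bijective (tilde.toOpen A V) := by
    subst hV
    exact (ConcreteCategory.isIso_iff_bijective _).1 inferInstance
  let l : A →ₗ[Γ(X, U)] Γ(tilde A, hU.fromSpec ⁻¹ᵁ U) := (tilde.toOpen A (hU.fromSpec ⁻¹ᵁ U)).hom
  let l' : A →ₗ[Γ(X, U)] Γ((pushforward hU.fromSpec).obj (tilde A), U) :=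
    { toFun := l
      map_add' := map_add l
      map_smul' := fun r x => (l.map_smul r x).trans
        (congrArg (fun t : Γ(Spec Γ(X, U), hU.fromSpec ⁻¹ᵁ U) => t • l x)
          (ConcreteCategory.congr_hom hU.fromSpec_app_self r).symm) }
  exact ⟨LinearEquiv.ofBijective l' (hbij _ hU.fromSpec_preimage_self)⟩

end Pushforward

/-! ### Exactness after sheafification -/

section Sheafification

open Limits

namespace PresheafOfModules

variable {C : Type u} [Category.{u} C] {J : GrothendieckTopology C} {R : Sheaf J RingCat.{u}}
  [HasSheafify J AddCommGrpCat.{u}] [J.WEqualsLocallyBijective AddCommGrpCat.{u}]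

/-- The sheaf associated with a presheaf of modules is zero if and only if all sections of the
presheaf are locally zero. -/
lemma isZero_sheafification_obj_iff (H : PresheafOfModules.{u} R.obj) :
    IsZero ((sheafification.{u} (𝟙 R.obj)).obj H) ↔
      ∀ (U : Cᵒᵖ) (z : H.presheaf.obj U),
        Presheaf.equalizerSieve (F := H.presheaf) z 0 ∈ J U.unop := by
  let adj := sheafificationAdjunction.{u} (𝟙 R.obj)
  -- Under the adjunction, the identity of the associated sheaf corresponds to the unit at `H`.
  have hunit : IsZero ((sheafification.{u} (𝟙 R.obj)).obj H) ↔ adj.unit.app H = 0 := by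
    rw [IsZero.iff_id_eq_zero, ← (adj.homEquiv _ _).apply_eq_iff_eq, adj.homEquiv_id]
    simp only [adj.homEquiv_apply, Functor.map_zero, comp_zero]
  have hmap : (toPresheaf _).map (adj.unit.app H) = CategoryTheory.toSheafify J H.presheaf := rfl
  rw [hunit]
  refine ⟨fun h U z => ?_, fun h => (toPresheaf _).map_injective ?_⟩
  · refine Presheaf.equalizerSieve_mem J (CategoryTheory.toSheafify J H.presheaf) z 0 ?_
    rw [← hmap, h, Functor.map_zero]
    rfl
  · rw [hmap, Functor.map_zero]
    ext U z
    refine Sheaf.isSeparated ((presheafToSheaf J AddCommGrpCat).obj H.presheaf) U.unop _ (h U z) _ _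
      fun V f hf => ?_
    have h1 := ConcreteCategory.congr_hom
      ((CategoryTheory.toSheafify J H.presheaf).naturality f.op) z
    have h2 : H.presheaf.map f.op z = H.presheaf.map f.op 0 := hf
    refine h1.symm.trans ((congrArg ((CategoryTheory.toSheafify J H.presheaf).app (op V))
      (h2.trans (map_zero _))).trans ?_)
    exact (map_zero _).trans (map_zero _).symm

variable (S : ShortComplex (PresheafOfModules.{u} R.obj))

/-- Sheafification is exact, so it commutes with homology. -/
lemma exact_map_sheafification_iff :
    (S.map (sheafification.{u} (𝟙 R.obj))).Exact ↔
      ∀ (U : Cᵒᵖ) (z : S.homology.presheaf.obj U),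
        Presheaf.equalizerSieve (F := S.homology.presheaf) z 0 ∈ J U.unop := by
  rw [ShortComplex.exact_iff_isZero_homology, (S.mapHomologyIso _).isZero_iff,
    isZero_sheafification_obj_iff]

variable {S}

/-- Only a presieve is required because affine opens are not closed under passing to smaller opens.
Evaluation is exact, so the homology presheaf vanishes on the members of `T`. -/
lemma exact_map_sheafification_of_exact
    (h : ∀ U : C, ∃ T : Presieve U, Sieve.generate T ∈ J U ∧ ∀ (V : C) (f : V ⟶ U), T f →
      Function.Exact (S.f.app (op V)) (S.g.app (op V))) :
    (S.map (sheafification.{u} (𝟙 R.obj))).Exact := by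
  rw [exact_map_sheafification_iff]
  intro U z
  obtain ⟨T, hT, hex⟩ := h U.unop
  refine J.superset_covering ((Sieve.generate_le_iff _ _).2 fun V f hf => ?_) hT
  have h1 : (S.map (evaluation R.obj (op V))).Exact :=
    (ShortComplex.ShortExact.moduleCat_exact_iff_function_exact _).2 (hex V f hf)
  rw [ShortComplex.exact_iff_isZero_homology, (S.mapHomologyIso _).isZero_iff] at h1
  have h2 : Subsingleton (S.homology.obj (op V)) := ModuleCat.subsingleton_of_isZero h1
  exact h2.elim _ _

/-- The homology class of the cycle `z` is locally zero, and wherever it is zero `z` is a boundary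
of presheaf sections. -/
lemma exists_map_eq_of_exact_map_sheafification (h : (S.map (sheafification.{u} (𝟙 R.obj))).Exact)
    (U : C) (z : S.X₂.obj (op U)) (hz : S.g.app (op U) z = 0) :
    ∃ T ∈ J U, ∀ (V : C) (f : V ⟶ U), T f →
      ∃ w : S.X₁.obj (op V), S.f.app (op V) w = S.X₂.presheaf.map f.op z := by
  rw [exact_map_sheafification_iff] at h
  let S₁ : ShortComplex (PresheafOfModules.{u} R.obj) :=
    ShortComplex.mk S.iCycles S.g S.iCycles_g
  let S₂ : ShortComplex (PresheafOfModules.{u} R.obj) :=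
    ShortComplex.mk S.toCycles S.homologyπ S.toCycles_comp_homologyπ
  have h₁ : (S₁.map (evaluation R.obj (op U))).Exact :=
    (S₁.exact_of_f_is_kernel S.cyclesIsKernel).map _
  have h₂ (V : C) : (S₂.map (evaluation R.obj (op V))).Exact :=
    (S₂.exact_of_g_is_cokernel S.homologyIsCokernel).map _
  rw [ShortComplex.ShortExact.moduleCat_exact_iff_function_exact] at h₁
  obtain ⟨c, hc⟩ := (h₁ z).1 hz
  refine ⟨_, h (op U) (S.homologyπ.app (op U) c), fun V f hf => ?_⟩
  have hf' : S.homology.presheaf.map f.op (S.homologyπ.app (op U) c) =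
    S.homology.presheaf.map f.op 0 := hf
  have h3 := (ShortComplex.ShortExact.moduleCat_exact_iff_function_exact _).1 (h₂ V)
  have h4 : S.homologyπ.app (op V) (S.cycles.presheaf.map f.op c) = 0 :=
    (naturality_apply S.homologyπ f.op c).trans (hf'.trans (map_zero _))
  obtain ⟨w, hw⟩ := (h3 _).1 h4
  refine ⟨w, ?_⟩
  have h5 : S.iCycles.app (op V) (S.toCycles.app (op V) w) = S.f.app (op V) w := by
    rw [← S.toCycles_i]
    rfl
  rw [← h5]
  refine (congrArg (S.iCycles.app (op V)) hw).trans ((naturality_apply S.iCycles f.op c).trans ?_)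
  exact congrArg (S.X₂.presheaf.map f.op) hc

end PresheafOfModules

end Sheafification

/-! ### Sheaf tensor products versus tensor products of sections -/

section SheafTensorExact

open Scheme.Modules TensorProduct

variable {X : Scheme.{u}}

/-- The short complex of presheaves of tensor products whose associated sheaves enter in
`SheafTensorExact`. -/
noncomputable def presheafTensorShortComplex (A : X.Modules) (F : ChainComplex X.Modules ℤ)
    (n : ℤ) : ShortComplex X.PresheafOfModules :=
  (F.sc' (n + 1) n (n - 1)).map (toPresheafOfModules X ⋙
    presheafTensorLeft ((toPresheafOfModules X).obj A))

lemma sheafTensorExact_iff (A : X.Modules) (F : ChainComplex X.Modules ℤ) :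
    SheafTensorExact A F ↔ ∀ n, ((presheafTensorShortComplex A F n).map
       (PresheafOfModules.sheafification.{u} (𝟙 X.ringCatSheaf.obj))).Exact := by
  refine forall_congr' fun n => ?_
  rw [HomologicalComplex.exactAt_iff' _ (n + 1) n (n - 1) (by simp) (by simp)]
  rfl

/-- The tensor product of sheaves is exact if the tensor products of sections over affine opens
are exact. -/
lemma SheafTensorExact.of_isAffineOpen {A : X.Modules} {F : ChainComplex X.Modules ℤ}
    (h : ∀ U : X.Opens, IsAffineOpen U →
      TensorExact (ModuleCat.of Γ(X, U) Γ(A, U)) (sectionsComplex F U)) :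
    SheafTensorExact A F := by
  refine (sheafTensorExact_iff A F).2 fun n =>
    PresheafOfModules.exact_map_sheafification_of_exact fun U =>
      ⟨fun V _ => IsAffineOpen V, fun x hx => ?_, fun V _ hV => ?_⟩
  · obtain ⟨_, ⟨V, hV, rfl⟩, hxV, hVU⟩ := X.isBasis_affineOpens.exists_subset_of_mem_open hx U.2
    exact ⟨V, homOfLE hVU, Sieve.le_generate (fun V _ => IsAffineOpen V) _ _ hV, hxV⟩
  · exact (tensorExact_sectionsComplex_iff _).1 (h V hV) n

lemma presheafTensorLeft_obj_map_eq {A M : X.Modules} {U : X.Opens} (f : Γ(X, U))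
    [IsLocalization.Away f Γ(X, X.basicOpen f)] (z : Γ(A, U) ⊗[Γ(X, U)] Γ(M, U)) :
    ((presheafTensorLeft ((toPresheafOfModules X).obj A)).obj
      ((toPresheafOfModules X).obj M)).presheaf.map (homOfLE (X.basicOpen_le f)).op z =
        tensorLocalizationMap (S := Γ(X, X.basicOpen f)) (Submonoid.powers f) (A.toBasicOpen f)
          (M.toBasicOpen f) z := by
  induction z with
  | zero => exact (map_zero _).trans (map_zero _).symm
  | add x y hx hy =>
    refine (map_add _ _ _).trans ((congrArg₂ (· + ·) hx hy).trans (map_add _ _ _).symm)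
  | tmul x y => rfl

/-- If the tensor product of quasi-coherent sheaves is exact, then the tensor products of sections
over affine opens are exact. -/
lemma SheafTensorExact.tensorExact {A : X.Modules} {F : ChainComplex X.Modules ℤ}
    (h : SheafTensorExact A F) (hA : A.IsQuasicoherent) (hF : ∀ n, (F.X n).IsQuasicoherent)
    {U : X.Opens} (hU : IsAffineOpen U) :
    TensorExact (ModuleCat.of Γ(X, U) Γ(A, U)) (sectionsComplex F U) := by
  refine (tensorExact_sectionsComplex_iff _).2 fun n z => ⟨fun hz => ?_, ?_⟩
  · obtain ⟨T, hT, hloc⟩ := PresheafOfModules.exists_map_eq_of_exact_map_sheafification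
      ((sheafTensorExact_iff A F).1 h n) U z hz
    -- Each point of `U` has a basic open neighbourhood inside a member of the sieve `T`, on which
    -- `z` becomes a boundary; clearing denominators puts its defining function in `s`.
    let s : Set Γ(X, U) := {f | ∃ k : ℕ, f ^ k • z ∈
      LinearMap.range ((appₗ (F.d (n + 1) n) U).lTensor Γ(A, U))}
    have hs : Ideal.span s = ⊤ := by
      rw [← hU.self_le_iSup_basicOpen_iff]
      intro x hx
      obtain ⟨V, i, hV, hxV⟩ := hT x hx
      obtain ⟨f, hfV, hxf⟩ := hU.exists_basicOpen_le ⟨x, hxV⟩ hx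
      have := hU.isLocalization_basicOpen f
      have := hU.isLocalizedModule_toBasicOpen hA f
      have (n : ℤ) := hU.isLocalizedModule_toBasicOpen (hF n) f
      obtain ⟨w, hw⟩ := hloc (X.basicOpen f) (homOfLE (X.basicOpen_le f))
        (T.downward_closed hV (homOfLE hfV))
      have hmem : tensorLocalizationMap (S := Γ(X, X.basicOpen f)) (Submonoid.powers f)
          (A.toBasicOpen f) ((F.X n).toBasicOpen f) z ∈
            LinearMap.range ((appₗ (F.d (n + 1) n) (X.basicOpen f)).lTensor
              Γ(A, X.basicOpen f)) :=
        ⟨w, hw.trans (presheafTensorLeft_obj_map_eq f z)⟩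
      obtain ⟨⟨_, k, rfl⟩, hk⟩ := exists_smul_mem_range_lTensor (S := Γ(X, X.basicOpen f))
        (Submonoid.powers f) (A.toBasicOpen f)
        (f := (F.X (n + 1)).toBasicOpen f) (g := (F.X n).toBasicOpen f)
        (u := appₗ (F.d (n + 1) n) U) (u' := appₗ (F.d (n + 1) n) (X.basicOpen f))
        (appₗ_toBasicOpen (F.d (n + 1) n) f) z
        hmem
      exact TopologicalSpace.Opens.mem_iSup.2 ⟨⟨f, k, hk⟩, hxf⟩
    exact Submodule.mem_of_span_eq_top_of_smul_pow_mem (LinearMap.range _) s hs z fun f => f.2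
  · rintro ⟨w, rfl⟩
    rw [← LinearMap.comp_apply, ← LinearMap.lTensor_comp, appₗ_d_comp_appₗ_d,
      LinearMap.lTensor_zero, LinearMap.zero_apply]

end SheafTensorExact

/-! ### Comparison of the test classes and the main theorem -/

section Main

open Scheme.Modules

variable {X : Scheme.{u}} {F : ChainComplex X.Modules ℤ}

/-- Exactness of the tensor product with all locally absolutely pure quasi-coherent sheaves can be
tested on sections. -/
lemma forall_sheafTensorExact_iff (hsep : IsSemiSeparatedScheme X)
    (hcoh : IsLocallyCoherentScheme X) (hF : ∀ n, (F.X n).IsQuasicoherent) :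
    (∀ A : X.Modules, A.IsQuasicoherent → IsLocallyAbsolutelyPure A → SheafTensorExact A F) ↔
      ∀ U : X.Opens, IsAffineOpen U → ∀ A : ModuleCat.{u} Γ(X, U),
        IsAbsolutelyPure Γ(X, U) A → TensorExact A (sectionsComplex F U) := by
  refine ⟨fun h U hU A hA => ?_, fun h A _ hA => SheafTensorExact.of_isAffineOpen fun U hU =>
    h U hU (ModuleCat.of Γ(X, U) Γ(A, U)) (hA U hU)⟩
  have := hsep.isAffineHom_fromSpec hU
  have hqc := isQuasicoherent_pushforward hU.fromSpec (M := tilde A) inferInstance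
  have hex := (h _ hqc
    (isLocallyAbsolutelyPure_pushforward_tilde hsep hU (hcoh U hU) hA)).tensorExact hqc hF hU
  obtain ⟨e⟩ := nonempty_linearEquiv_pushforward_tilde hU A
  -- An isomorphism is in particular a pure monomorphism, so exactness moves from the sections of
  -- the pushforward to `A`.
  exact hex.of_isPureMono (f := e.toLinearMap) fun P _ _ => (e.lTensor P).injective

lemma forall_tensorExact_injective_iff {R : Type u} [CommRing R]
    {K : ChainComplex (ModuleCat.{u} R) ℤ} :
    (∀ I : ModuleCat.{u} R, Module.Injective R I → TensorExact I K) ↔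
      ∀ A : ModuleCat.{u} R, IsAbsolutelyPure R A → TensorExact A K :=
  ⟨fun h A hA => TensorExact.of_isAbsolutelyPure h A hA,
    fun h I hI => h I hI.isFPInjective.isAbsolutelyPure⟩

/-- Over a coherent ring, AC-acyclicity can be tested on absolutely pure modules. -/
lemma isACAcyclicComplex_iff {R : Type u} [CommRing R] (hR : IsCoherentRing R)
    {K : ChainComplex (ModuleCat.{u} R) ℤ} :
    IsACAcyclicComplex K ↔ (∀ n, Module.Flat R (K.X n)) ∧
      ∀ A : ModuleCat.{u} R, IsAbsolutelyPure R A → TensorExact A K :=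
  and_congr_right fun _ =>
    -- Absolutely clean modules lie between the injective and, by coherence, the absolutely pure
    -- ones, and the two outer classes impose the same condition.
    ⟨fun h => forall_tensorExact_injective_iff.1 fun I _ =>
      h I (Module.Injective.isAbsolutelyClean I),
    fun h A hA => h A (hA.isFPInjective hR).isAbsolutelyPure⟩

lemma isACAcyclic_iff (hcoh : IsLocallyCoherentScheme X) :
    IsACAcyclic F ↔ (∀ n, IsFlatSheaf (F.X n)) ∧
      ∀ U : X.Opens, IsAffineOpen U → ∀ A : ModuleCat.{u} Γ(X, U),
        IsAbsolutelyPure Γ(X, U) A → TensorExact A (sectionsComplex F U) :=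
  ⟨fun h => ⟨fun n U hU => (h U hU).1 n,
      fun U hU => ((isACAcyclicComplex_iff (hcoh U hU)).1 (h U hU)).2⟩,
    fun h U hU => (isACAcyclicComplex_iff (hcoh U hU)).2 ⟨fun n => h.1 n U hU, h.2 U hU⟩⟩

lemma isACAcyclicOnSomeCovering_iff (hcoh : IsLocallyCoherentScheme X)
    (hF : ∀ n, (F.X n).IsQuasicoherent) : IsACAcyclicOnSomeCovering F ↔ IsACAcyclic F := by
  refine ⟨fun ⟨𝒰, h𝒰, h⟩ => (isACAcyclic_iff hcoh).2 ⟨fun n => ?_, ?_⟩,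
    fun h => ⟨_, isAffineCovering_affineOpens X, h⟩⟩
  · exact isFlatSheaf_of_isAffineCovering (hF n) h𝒰 fun U hU => (h U hU).1 n
  · exact h𝒰.tensorExact hcoh hF fun U hU =>
      ((isACAcyclicComplex_iff (hcoh U (h𝒰.1 U hU))).1 (h U hU)).2

end Main

theorem theorem1p1 (X : Scheme.{u}) (hsep : IsSemiSeparatedScheme X)
    (hcoh : IsLocallyCoherentScheme X) :
    -- local absolute purity of quasi-coherent sheaves can be tested on some affine covering
    (∀ A : X.Modules, A.IsQuasicoherent →
      (IsLocallyAbsolutelyPure A ↔ IsAbsolutelyPureOnSomeCovering A)) ∧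
    -- the characterizations of AC-acyclicity of a complex of flat quasi-coherent sheaves
    (∀ F : ChainComplex X.Modules ℤ, (∀ n, (F.X n).IsQuasicoherent) → (∀ n, IsFlatSheaf (F.X n)) →
      List.TFAE [
        ∀ A : X.Modules, A.IsQuasicoherent → IsLocallyAbsolutelyPure A → SheafTensorExact A F,
        ∀ A : X.Modules, A.IsQuasicoherent → IsAbsolutelyPureOnSomeCovering A →
          SheafTensorExact A F,
        ∀ U : X.Opens, IsAffineOpen U → ∀ A : ModuleCat.{u} Γ(X, U),
          IsAbsolutelyPure Γ(X, U) A → TensorExact A (sectionsComplex F U),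
        ∃ 𝒰 : Set X.Opens, IsAffineCovering 𝒰 ∧ ∀ U ∈ 𝒰, ∀ A : ModuleCat.{u} Γ(X, U),
          IsAbsolutelyPure Γ(X, U) A → TensorExact A (sectionsComplex F U),
        ∀ U : X.Opens, IsAffineOpen U → ∀ I : ModuleCat.{u} Γ(X, U),
          Module.Injective Γ(X, U) I → TensorExact I (sectionsComplex F U),
        ∃ 𝒰 : Set X.Opens, IsAffineCovering 𝒰 ∧ ∀ U ∈ 𝒰, ∀ I : ModuleCat.{u} Γ(X, U),
          Module.Injective Γ(X, U) I → TensorExact I (sectionsComplex F U),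
        IsACAcyclic F,
        IsACAcyclicOnSomeCovering F]) ∧
    -- being an AC-acyclic complex of flat sheaves is Zariski-local
    (∀ F : ChainComplex X.Modules ℤ, (∀ n, (F.X n).IsQuasicoherent) →
      (IsACAcyclic F ↔ IsACAcyclicOnSomeCovering F)) := by
  refine ⟨fun A hA => isLocallyAbsolutelyPure_iff hcoh hA, fun F hF hflat => ?_,
    fun F hF => (isACAcyclicOnSomeCovering_iff hcoh hF).symm⟩
  tfae_have 1 ↔ 2 := forall_congr' fun A => forall_congr' fun hA =>
    imp_congr_left (isLocallyAbsolutelyPure_iff hcoh hA)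
  tfae_have 1 ↔ 3 := forall_sheafTensorExact_iff hsep hcoh hF
  tfae_have 3 → 4 := fun h => ⟨_, isAffineCovering_affineOpens X, h⟩
  tfae_have 4 → 3 := fun ⟨𝒰, h𝒰, h⟩ => h𝒰.tensorExact hcoh hF h
  tfae_have 3 ↔ 5 := forall₂_congr fun _ _ => forall_tensorExact_injective_iff.symm
  tfae_have 4 ↔ 6 := exists_congr fun _ => and_congr_right fun _ =>
    forall₂_congr fun _ _ => forall_tensorExact_injective_iff.symm
  tfae_have 7 ↔ 3 := (isACAcyclic_iff hcoh).trans (and_iff_right hflat)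
  tfae_have 8 ↔ 7 := isACAcyclicOnSomeCovering_iff hcoh hF
  tfae_finish
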